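/- All locally compact spaces are assumed second countable and Hausdorff. \emph{Continuous families.} Let $U\subseteq T\times\mathbb R^k$ be open. A function $f$ on $U$ with values in $\mathbb R^l$ or $\mathbb C$ is $C^{\infty,0}$ if each $f^t=f(t,\cdot)$ is smooth and $t\mapsto f^t$ is continuous for the topology of uniform convergence on compact sets of all derivatives. A \emph{continuous family of manifolds} $(X,p)$ over $T$ is a continuous open surjection $p:X\to T$ of locally compact spaces with an atlas of fibre preserving homeomorphisms $\phi:U\to p(U)\times V$ ($U\subseteq X$ and $V\subseteq\mathbb R^k$ open, $k\ge 1$ fixed) whose coordinate changes are $C^{\infty,0}$ (in their $\mathbb R^k$-component). A \emph{morphism} $(f,q):(X_1,p_1)\to(X_2,p_2)$ consists of continuous maps $f:X_1\to X_2$, $q:T_1\to T_2$ with $p_2\circ f=q\circ p_1$ such that $f$ is $C^{\infty,0}$ in local coordinates. $C^{\infty,0}_c(X)$ is the set of continuous compactly supported functions $X\to\mathbb C$ that are $C^{\infty,0}$ in the charts. For a continuous map $t:Z\to T$, the pull-back $\{(z,x): t(z)=p(x)\}$ with projection $(z,x)\mapsto z$ is a continuous family over $Z$ in the natural way. \emph{Groupoids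 and actions.} A \emph{continuous family groupoid} is a locally compact groupoid $G$ with range and source maps $r,s:G\to G^0$ such that $(G,s)$ and $(G,r)$ are continuous families of manifolds over $G^0$, inversion is a diffeomorphism $(G,r)\to(G,s)$ (it and its inverse are morphisms over the identity of $G^0$), and multiplication $m$ gives a morphism $(m,r)$ from $\{(g,h):s(g)=r(h)\}$ (over $G$ via $(g,h)\mapsto g$, the pull-back of $(G,r)$ along $s$) to $(G,r)$. A \emph{$C^{\infty,0}$ $G$-space} is a continuous family of manifolds $(X,p)$ over $G^0$ with a continuous map $n:G*X=\{(g,x): s(g)=p(x)\}\to X$, $(g,x)\mapsto gx$, satisfying $p(gx)=r(g)$, $g_1(g_2x)=(g_1g_2)x$, $g^{-1}(gx)=x$, such that $(n,r)$ is a morphism from $G*X$ (over $G$ via $(g,x)\mapsto g$) to $(X,p)$. It is \emph{proper} if $(g,x)\mapsto(gx,x)$, $G*X\to X\times X$, is proper, and \emph{$G$-compact} if $X=GC$ for some compact $C\subseteq X$. \emph{Haar systems.} A \emph{continuous left Haar system} on $G$ is a family of positive regular Borel measures $\lambda^u$ on $G^u=r^{-1}(u)$, $u\in G^0$, with support $G^u$,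 such that in every chart $U\cong r(U)\times W$ of $(G,r)$ the measures induced by the $\lambda^u$ on $W$ have a Radon--Nikodym derivative with respect to Lebesgue measure that is continuous on $r(U)\times W$, and such that $\int_{G^{s(g)}}f(gh)\,d\lambda^{s(g)}(h)=\int_{G^{r(g)}}f(h)\,d\lambda^{r(g)}(h)$ for all $g\in G$ and $f\in C_c(G)$. \textbf{Proposition.} Let $G$ be a continuous family groupoid, $\{\lambda^u\}$ a continuous left Haar system on $G$, and $(X,p)$ a proper $C^{\infty,0}$ $G$-space. If $X$ is $G$-compact, then there exists a non-negative $c\in C^{\infty,0}_c(X)$ such that \[\int_{G^{p(x)}}c(g^{-1}x)\,d\lambda^{p(x)}(g)=1\qquad\text{for all }x\in X.\] -/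

import Mathlib

open Set Filter MeasureTheory
open scoped Topology ContDiff NNReal ENNReal ComplexOrder

/-! ### Fibrewise smooth, transversally continuous functions -/

/-- Let `U` be an open subset of `T × E` and `f : T × E → F`. Writing `f^t = f (t, ·)`, the function
`f` is `C^{∞,0}` on `U` if every `f^t` is smooth on the slice `U^t = {w | (t, w) ∈ U}` and
`t ↦ f^t` is continuous for the topology of uniform convergence on compact sets of all
derivatives: for every `t`, every compact `K ⊆ U^t` and every order `n`, the `n`-th derivative of
`f^{t'}` converges to that of `f^t` uniformly on `K` as `t' → t`. (As `U` is open, `K ⊆ U^{t'}` for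
all `t'` close to `t`.) -/
def CInfZeroOn {T E F : Type*} [TopologicalSpace T]
    [NormedAddCommGroup E] [NormedSpace ℝ E] [NormedAddCommGroup F] [NormedSpace ℝ F]
    (f : T × E → F) (U : Set (T × E)) : Prop :=
  ∀ t : T,
    ContDiffOn ℝ ∞ (fun w => f (t, w)) {w | (t, w) ∈ U} ∧
    ∀ (n : ℕ) (K : Set E), IsCompact K → K ⊆ {w | (t, w) ∈ U} →
      TendstoUniformlyOn (fun (t' : T) (w : E) => iteratedFDeriv ℝ n (fun v => f (t', v)) w)
        (fun w : E => iteratedFDeriv ℝ n (fun v => f (t, v)) w) (𝓝 t) K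

/-- `C^{∞,0}` on an open set only depends on the values on that set. -/
theorem CInfZeroOn.congr {T E F : Type*} [TopologicalSpace T]
    [NormedAddCommGroup E] [NormedSpace ℝ E] [NormedAddCommGroup F] [NormedSpace ℝ F]
    {f g : T × E → F} {U : Set (T × E)} (hU : IsOpen U) (hf : CInfZeroOn f U)
    (hfg : ∀ z ∈ U, g z = f z) : CInfZeroOn g U := by
  have key : ∀ (n : ℕ) (z : T × E), z ∈ U →
      iteratedFDeriv ℝ n (fun v => g (z.1, v)) z.2 =
        iteratedFDeriv ℝ n (fun v => f (z.1, v)) z.2 := by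
    intro n z hz
    have h : (fun v => g (z.1, v)) =ᶠ[𝓝 z.2] (fun v => f (z.1, v)) := by
      have hc : Continuous (fun v : E => (z.1, v)) := by fun_prop
      filter_upwards [(hU.preimage hc).mem_nhds (show z.2 ∈ _ from hz)] with v hv
      exact hfg _ hv
    exact (h.iteratedFDeriv ℝ n).eq_of_nhds
  intro t
  refine ⟨(hf t).1.congr fun w hw => hfg _ hw, fun n K hK hKU => ?_⟩
  have h1 := (hf t).2 n K hK hKU
  have h2 : ∀ᶠ t' in 𝓝 t, ∀ w ∈ K, (t', w) ∈ U := by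
    have := generalized_tube_lemma (s := {t}) (t := K) isCompact_singleton hK hU
      (by
        rintro ⟨a, b⟩ ⟨ha, hb⟩
        have ha' : a = t := ha
        subst ha'
        exact hKU hb)
    obtain ⟨u, v, hu, _, htu, hKv, huv⟩ := this
    filter_upwards [hu.mem_nhds (htu rfl)] with t' ht' w hw
    exact huv ⟨ht', hKv hw⟩
  have h3 := h1.congr (F' := fun (t' : T) (w : E) =>
      iteratedFDeriv ℝ n (fun v => g (t', v)) w) (by
    filter_upwards [h2] with t' ht' w hw
    exact (key n (t', w) (ht' w hw)).symm)
  exact h3.congr_right fun w hw => (key n (t, w) (hKU hw)).symm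

/-- Base change of a `C^{∞,0}` function along a continuous map of the parameter spaces. -/
theorem CInfZeroOn.baseChange {T Z E F : Type*} [TopologicalSpace T] [TopologicalSpace Z]
    [NormedAddCommGroup E] [NormedSpace ℝ E] [NormedAddCommGroup F] [NormedSpace ℝ F]
    {f : T × E → F} {U : Set (T × E)} (hf : CInfZeroOn f U) {t : Z → T} (ht : Continuous t) :
    CInfZeroOn (fun z : Z × E => f (t z.1, z.2)) {z | (t z.1, z.2) ∈ U} := by
  intro z
  refine ⟨(hf (t z)).1, fun n K hK hKU => ?_⟩
  have h := (hf (t z)).2 n K hK hKU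
  intro u hu
  exact ht.continuousAt.eventually (h u hu)

/-! ### Continuous families of manifolds -/

/-- A continuous family of `k`-dimensional manifolds `(X, p)` over `T` (with `k ≥ 1`): a continuous
open surjection `p : X → T` with an atlas of fibre preserving homeomorphisms `φ` from open subsets
`U` of `X` onto `p(U) × V`, `V ⊆ ℝ^k` open, whose coordinate changes are `C^{∞,0}`. (The first
component of a coordinate change is the identity.) The atlas need not be maximal; none of the
notions below changes when it is enlarged by compatible charts. -/
structure ContFamily {T X : Type*} [TopologicalSpace T] [TopologicalSpace X] (p : X → T) where
  continuous_proj : Continuous p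
  isOpenMap_proj : IsOpenMap p
  surjective_proj : Function.Surjective p
  dim : ℕ
  one_le_dim : 1 ≤ dim
  atlas : Set (OpenPartialHomeomorph X (T × EuclideanSpace ℝ (Fin dim)))
  cover : ∀ x : X, ∃ φ ∈ atlas, x ∈ φ.source
  fibre_preserving : ∀ φ ∈ atlas, ∀ x ∈ φ.source, (φ x).1 = p x
  target_eq : ∀ φ ∈ atlas, ∃ V : Set (EuclideanSpace ℝ (Fin dim)),
    IsOpen V ∧ φ.target = (p '' φ.source) ×ˢ V
  compatible : ∀ φ ∈ atlas, ∀ ψ ∈ atlas,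
    CInfZeroOn (fun z => (ψ (φ.symm z)).2) (φ.target ∩ φ.symm ⁻¹' ψ.source)

namespace ContFamily

variable {T X : Type*} [TopologicalSpace T] [TopologicalSpace X] {p : X → T}

theorem proj_symm (𝓧 : ContFamily p) {φ : OpenPartialHomeomorph X (T × EuclideanSpace ℝ (Fin 𝓧.dim))}
    (hφ : φ ∈ 𝓧.atlas) {z : T × EuclideanSpace ℝ (Fin 𝓧.dim)} (hz : z ∈ φ.target) :
    p (φ.symm z) = z.1 := by
  rw [← 𝓧.fibre_preserving φ hφ _ (φ.map_target hz), φ.right_inv hz]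

variable {Z : Type*} [TopologicalSpace Z]

open Classical in
/-- The chart `t⁻¹(p(U)) × V` of the pull-back family `{(z, x) | t z = p x}` over `Z` that is
induced by a chart `U ≃ p(U) × V` of `X`: it sends `(z, x)` with `x ∈ U` to `(z, w)`, where
`φ x = (p x, w)`. -/
noncomputable def pullbackChart (𝓧 : ContFamily p) {t : Z → T} (ht : Continuous t)
    (φ : OpenPartialHomeomorph X (T × EuclideanSpace ℝ (Fin 𝓧.dim))) (hφ : φ ∈ 𝓧.atlas) :
    OpenPartialHomeomorph {a : Z × X // t a.1 = p a.2} (Z × EuclideanSpace ℝ (Fin 𝓧.dim)) where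
  toFun a := (a.1.1, (φ a.1.2).2)
  invFun b :=
    if h : (t b.1, b.2) ∈ φ.target then
      ⟨(b.1, φ.symm (t b.1, b.2)), (𝓧.proj_symm hφ h).symm⟩
    else ⟨(b.1, Function.surjInv 𝓧.surjective_proj (t b.1)),
      (Function.surjInv_eq 𝓧.surjective_proj (t b.1)).symm⟩
  source := {a | a.1.2 ∈ φ.source}
  target := {b | (t b.1, b.2) ∈ φ.target}
  map_source' := by
    rintro ⟨⟨z, x⟩, h⟩ hx
    have h' : t z = p x := h
    have : φ x = (t z, (φ x).2) := Prod.ext ((𝓧.fibre_preserving φ hφ x hx).trans h'.symm) rfl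
    change (t z, (φ x).2) ∈ φ.target
    rw [← this]
    exact φ.map_source hx
  map_target' := by
    rintro ⟨z, w⟩ h
    have h' : (t z, w) ∈ φ.target := h
    simp only [h', dif_pos]
    exact φ.map_target h'
  left_inv' := by
    rintro ⟨⟨z, x⟩, h⟩ hx
    have h' : t z = p x := h
    have e : (t z, (φ x).2) = φ x :=
      (Prod.ext ((𝓧.fibre_preserving φ hφ x hx).trans h'.symm) rfl : φ x = (t z, (φ x).2)).symm
    have hm : (t z, (φ x).2) ∈ φ.target := e ▸ φ.map_source hx
    apply Subtype.ext
    simp only [hm, dif_pos]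
    rw [e, φ.left_inv hx]
  right_inv' := by
    rintro ⟨z, w⟩ h
    have h' : (t z, w) ∈ φ.target := h
    simp only [h', dif_pos, φ.right_inv h']
  open_source := φ.open_source.preimage (by fun_prop)
  open_target := φ.open_target.preimage (by fun_prop)
  continuousOn_toFun := by
    have h1 : ContinuousOn (fun a : {a : Z × X // t a.1 = p a.2} => φ a.1.2)
        {a | a.1.2 ∈ φ.source} :=
      φ.continuousOn.comp (by fun_prop : Continuous _).continuousOn (fun a ha => ha)
    exact (by fun_prop : Continuous _).continuousOn.prodMk (continuous_snd.comp_continuousOn h1)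
  continuousOn_invFun := by
    have h1 : ContinuousOn
        (fun b : Z × EuclideanSpace ℝ (Fin 𝓧.dim) => (b.1, φ.symm (t b.1, b.2)))
        {b | (t b.1, b.2) ∈ φ.target} :=
      continuous_fst.continuousOn.prodMk
        (φ.symm.continuousOn.comp (by fun_prop : Continuous _).continuousOn (fun a ha => ha))
    refine Topology.IsInducing.subtypeVal.continuousOn_iff.2 ?_
    refine h1.congr fun b hb => ?_
    have hb' : (t b.1, b.2) ∈ φ.target := hb
    simp only [Function.comp, hb', dif_pos]

/-- The pull-back of a continuous family `(X, p)` over `T` along a continuous map `t : Z → T`: the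
family `{(z, x) | t z = p x}` over `Z`, with projection `(z, x) ↦ z`. -/
noncomputable def pullback (𝓧 : ContFamily p) {t : Z → T} (ht : Continuous t) :
    ContFamily (fun a : {a : Z × X // t a.1 = p a.2} => a.1.1) where
  continuous_proj := by fun_prop
  isOpenMap_proj := by
    intro O hO
    rw [isOpen_induced_iff] at hO
    obtain ⟨O', hO', rfl⟩ := hO
    rw [isOpen_iff_mem_nhds]
    rintro _ ⟨⟨⟨z, x⟩, h⟩, hm, rfl⟩
    have h' : t z = p x := h
    obtain ⟨A, C, hA, hC, hz, hx, hAC⟩ := isOpen_prod_iff.1 hO' z x hm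
    have h1 : t ⁻¹' (p '' C) ∈ 𝓝 z :=
      ((𝓧.isOpenMap_proj C hC).preimage ht).mem_nhds ⟨x, hx, h'.symm⟩
    filter_upwards [h1, hA.mem_nhds hz] with z' h1 h2
    obtain ⟨x', hx', e⟩ := h1
    exact ⟨⟨(z', x'), e.symm⟩, hAC ⟨h2, hx'⟩, rfl⟩
  surjective_proj z := by
    obtain ⟨x, hx⟩ := 𝓧.surjective_proj (t z)
    exact ⟨⟨(z, x), hx.symm⟩, rfl⟩
  dim := 𝓧.dim
  one_le_dim := 𝓧.one_le_dim
  atlas := {χ | ∃ (φ : _) (hφ : φ ∈ 𝓧.atlas), χ = 𝓧.pullbackChart ht φ hφ}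
  cover := by
    rintro ⟨⟨z, x⟩, h⟩
    obtain ⟨φ, hφ, hx⟩ := 𝓧.cover x
    exact ⟨_, ⟨φ, hφ, rfl⟩, hx⟩
  fibre_preserving := by
    rintro _ ⟨φ, hφ, rfl⟩ x hx
    rfl
  target_eq := by
    rintro _ ⟨φ, hφ, rfl⟩
    obtain ⟨V, hV, hφV⟩ := 𝓧.target_eq φ hφ
    refine ⟨V, hV, ?_⟩
    ext ⟨z, w⟩
    change (t z, w) ∈ φ.target ↔ _
    rw [hφV]
    constructor
    · rintro ⟨⟨x, hx, e⟩, hw⟩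
      exact ⟨⟨⟨(z, x), e.symm⟩, hx, rfl⟩, hw⟩
    · rintro ⟨⟨⟨⟨z', x⟩, h⟩, hx, e⟩, hw⟩
      have h' : t z' = p x := h
      have e' : z' = z := e
      exact ⟨⟨x, hx, by rw [← h', e']⟩, hw⟩
  compatible := by
    rintro _ ⟨φ, hφ, rfl⟩ _ ⟨ψ, hψ, rfl⟩
    have key : ∀ (b : Z × EuclideanSpace ℝ (Fin 𝓧.dim)) (_ : (t b.1, b.2) ∈ φ.target),
        ((𝓧.pullbackChart ht φ hφ).symm b).1.2 = φ.symm (t b.1, b.2) := by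
      intro b hb
      exact congrArg (fun a : {a : Z × X // t a.1 = p a.2} => a.1.2) (dif_pos hb)
    have hset : (𝓧.pullbackChart ht φ hφ).target ∩
        (𝓧.pullbackChart ht φ hφ).symm ⁻¹' (𝓧.pullbackChart ht ψ hψ).source =
        {b | (t b.1, b.2) ∈ φ.target ∩ φ.symm ⁻¹' ψ.source} := by
      ext b
      constructor
      · rintro ⟨h1, h2⟩
        refine ⟨h1, ?_⟩
        have h2' : ((𝓧.pullbackChart ht φ hφ).symm b).1.2 ∈ ψ.source := h2
        rw [key b h1] at h2'
        exact h2'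
      · rintro ⟨h1, h2⟩
        refine ⟨h1, ?_⟩
        change ((𝓧.pullbackChart ht φ hφ).symm b).1.2 ∈ ψ.source
        rw [key b h1]
        exact h2
    rw [hset]
    refine CInfZeroOn.congr ?_ ((𝓧.compatible φ hφ ψ hψ).baseChange ht) ?_
    · exact (φ.symm.isOpen_inter_preimage ψ.open_source).preimage (by fun_prop)
    · intro b hb
      change (ψ ((𝓧.pullbackChart ht φ hφ).symm b).1.2).2 = _
      rw [key b hb.1]

/-- `(f, q)` is a morphism (a `C^{∞,0}` map) from the continuous family `(X₁, p₁)` to `(X₂, p₂)`: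
`f` and `q` are continuous, `p₂ ∘ f = q ∘ p₁`, and the expressions `(t, w) ↦ (q t, f^t w)` of `f`
in the charts are `C^{∞,0}`. -/
structure IsMorphism {T₁ X₁ T₂ X₂ : Type*} [TopologicalSpace T₁] [TopologicalSpace X₁]
    [TopologicalSpace T₂] [TopologicalSpace X₂] {p₁ : X₁ → T₁} {p₂ : X₂ → T₂}
    (𝓧₁ : ContFamily p₁) (𝓧₂ : ContFamily p₂) (f : X₁ → X₂) (q : T₁ → T₂) : Prop where
  continuous_map : Continuous f
  continuous_base : Continuous q
  comm : ∀ x, p₂ (f x) = q (p₁ x)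
  cInfZero : ∀ φ ∈ 𝓧₁.atlas, ∀ ψ ∈ 𝓧₂.atlas,
    CInfZeroOn (fun z => (ψ (f (φ.symm z))).2) (φ.target ∩ φ.symm ⁻¹' (f ⁻¹' ψ.source))

/-- `f ∈ C_c^{∞,0}(X)`: the function `f : X → ℂ` is continuous, it has compact support, and its
expressions in the charts are `C^{∞,0}`. -/
structure MemCcInfZero (𝓧 : ContFamily p) (f : X → ℂ) : Prop where
  continuous : Continuous f
  hasCompactSupport : HasCompactSupport f
  cInfZero : ∀ φ ∈ 𝓧.atlas, CInfZeroOn (fun z => f (φ.symm z)) φ.target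

end ContFamily

/-! ### Groupoids -/

/-- A topological groupoid with arrow space `G` and unit space `B`. The product `g h` is defined
when `s g = r h`. (`unit` is a homeomorphism of `B` onto the space of units of `G`.) -/
structure TopGroupoid (B G : Type*) [TopologicalSpace B] [TopologicalSpace G] where
  r : G → B
  s : G → B
  unit : B → G
  inv : G → G
  mul : (g h : G) → s g = r h → G
  r_unit : ∀ u, r (unit u) = u
  s_unit : ∀ u, s (unit u) = u
  r_inv : ∀ g, r (inv g) = s g
  s_inv : ∀ g, s (inv g) = r g
  r_mul : ∀ g h (e : s g = r h), r (mul g h e) = r g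
  s_mul : ∀ g h (e : s g = r h), s (mul g h e) = s h
  unit_mul : ∀ g, mul (unit (r g)) g (s_unit (r g)) = g
  mul_unit : ∀ g, mul g (unit (s g)) (r_unit (s g)).symm = g
  mul_assoc : ∀ g h k (e₁ : s g = r h) (e₂ : s h = r k),
    mul (mul g h e₁) k ((s_mul g h e₁).trans e₂) = mul g (mul h k e₂) (e₁.trans (r_mul h k e₂).symm)
  inv_mul : ∀ g, mul (inv g) g (s_inv g) = unit (s g)
  mul_inv : ∀ g, mul g (inv g) (r_inv g).symm = unit (r g)
  continuous_r : Continuous r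
  continuous_s : Continuous s
  continuous_unit : Continuous unit
  continuous_inv : Continuous inv
  continuous_mul : Continuous fun a : {a : G × G // s a.1 = r a.2} => mul a.1.1 a.1.2 a.2

/-- A continuous family groupoid: `(G, s)` and `(G, r)` are continuous families of manifolds over
the unit space, inversion is a diffeomorphism `(G, r) → (G, s)`, and multiplication gives a morphism
`(m, r)` from `(G * G, t₁)` to `(G, r)`, where `G * G = {(g, h) | s g = r h}`, `t₁ (g, h) = g`, is
the pull-back of `(G, r)` along `s`. -/
structure ContFamilyGroupoid (B G : Type*) [TopologicalSpace B] [TopologicalSpace G]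
    extends TopGroupoid B G where
  famS : ContFamily s
  famR : ContFamily r
  inv_morphism : famR.IsMorphism famS inv id
  inv_morphism' : famS.IsMorphism famR inv id
  mul_morphism : (famR.pullback continuous_s).IsMorphism famR
    (fun a : {a : G × G // s a.1 = r a.2} => mul a.1.1 a.1.2 a.2) r

namespace ContFamilyGroupoid

variable {B G : Type*} [TopologicalSpace B] [TopologicalSpace G]

/-- A continuous left Haar system on a continuous family groupoid: positive regular Borel measures
`λ^u` on the fibres `G^u = r⁻¹(u)` with support `G^u`, left invariant, and such that in every chart
`U ≃ r(U) × W` of `(G, r)` the images of the `λ^u` on `W` have Radon-Nikodym derivatives with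
respect to Lebesgue measure that are given by a continuous function on `r(U) × W`. -/
structure IsContinuousLeftHaarSystem [MeasurableSpace G] [BorelSpace G]
    (𝓖 : ContFamilyGroupoid B G) (lam : (u : B) → Measure {g : G // 𝓖.r g = u}) : Prop where
  regular : ∀ u, (lam u).Regular
  support_eq : ∀ u, (lam u).support = univ
  density : ∀ φ ∈ 𝓖.famR.atlas, ∃ d : B × EuclideanSpace ℝ (Fin 𝓖.famR.dim) → ℝ≥0,
    ContinuousOn d φ.target ∧
    ∀ u ∈ 𝓖.r '' φ.source,
      ((lam u).restrict {g | g.1 ∈ φ.source}).map (fun g => (φ g.1).2) =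
        (volume.restrict {w | (u, w) ∈ φ.target}).withDensity (fun w => (d (u, w) : ℝ≥0∞))
  left_invariant : ∀ (g : G) (f : G → ℂ), Continuous f → HasCompactSupport f →
    ∫ h : {h : G // 𝓖.r h = 𝓖.s g}, f (𝓖.mul g h.1 h.2.symm) ∂(lam (𝓖.s g)) =
      ∫ h : {h : G // 𝓖.r h = 𝓖.r g}, f h.1 ∂(lam (𝓖.r g))

end ContFamilyGroupoid

/-! ### Actions -/

/-- A `C^{∞,0}` `G`-space `(X, p)`: a continuous family of manifolds over the unit space with a
continuous action of `G`, `(g, x) ↦ g x` for `s g = p x`, that gives a morphism `(n, r)` from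
`(G * X, t₁)` to `(X, p)`, where `G * X = {(g, x) | s g = p x}`, `t₁ (g, x) = g`, is the pull-back
of `(X, p)` along `s`. -/
structure CInfZeroGSpace {B G X : Type*} [TopologicalSpace B] [TopologicalSpace G]
    [TopologicalSpace X] (𝓖 : ContFamilyGroupoid B G) (p : X → B) where
  fam : ContFamily p
  act : (g : G) → (x : X) → 𝓖.s g = p x → X
  proj_act : ∀ g x (e : 𝓖.s g = p x), p (act g x e) = 𝓖.r g
  act_act : ∀ g h x (e₁ : 𝓖.s g = 𝓖.r h) (e₂ : 𝓖.s h = p x),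
    act g (act h x e₂) (e₁.trans (proj_act h x e₂).symm) =
      act (𝓖.mul g h e₁) x ((𝓖.s_mul g h e₁).trans e₂)
  inv_act_act : ∀ g x (e : 𝓖.s g = p x),
    act (𝓖.inv g) (act g x e) ((𝓖.s_inv g).trans (proj_act g x e).symm) = x
  continuous_act : Continuous fun a : {a : G × X // 𝓖.s a.1 = p a.2} => act a.1.1 a.1.2 a.2
  act_morphism : (fam.pullback 𝓖.continuous_s).IsMorphism fam
    (fun a : {a : G × X // 𝓖.s a.1 = p a.2} => act a.1.1 a.1.2 a.2) 𝓖.r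

namespace CInfZeroGSpace

variable {B G X : Type*} [TopologicalSpace B] [TopologicalSpace G] [TopologicalSpace X]
  {𝓖 : ContFamilyGroupoid B G} {p : X → B}

/-- The action is proper: under `(g, x) ↦ (g x, x)`, `G * X → X × X`, inverse images of compact
sets are compact. -/
def IsProper (𝓧 : CInfZeroGSpace 𝓖 p) : Prop :=
  ∀ K : Set (X × X), IsCompact K →
    IsCompact ((fun a : {a : G × X // 𝓖.s a.1 = p a.2} => (𝓧.act a.1.1 a.1.2 a.2, a.1.2)) ⁻¹' K)

/-- `X` is `G`-compact: `X = G C` for a compact subset `C` of `X`. -/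
def IsGCompact (𝓧 : CInfZeroGSpace 𝓖 p) : Prop :=
  ∃ C : Set X, IsCompact C ∧
    ∀ x : X, ∃ (g : G) (y : X) (e : 𝓖.s g = p y), y ∈ C ∧ 𝓧.act g y e = x

end CInfZeroGSpace

/-! ### Pointwise description of `C^{∞,0}` functions -/

/-! Choose a smooth non-negative `b` of compact support that is positive on `C`, let `A x` be the
integral of `b (g⁻¹ x)` over the fibre of `G` above `p x`, and put `c = b / A`. Properness makes
each integrand compactly supported. Every orbit meets `C` and the Haar measures have full support,
so `A > 0`. Left invariance gives `A (h y) = A y`, so `1 / A` comes out of the integral of `c` along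
an orbit, which is therefore `A x / A x = 1`.

The main work is to show that `A` is again `C^{∞,0}` (`isSmooth_average`). Near a point of `X`,
properness confines all relevant `g` to one compact set (`IsProper.exists_isCompact`). In a chart of
`X`, `A` is thus a fibre integral of a function of `(g, w)` that is smooth in `w`, with all
`w`-derivatives jointly continuous and supported in a fixed compact set of `g`.
`hasFDerivAt_integral_fibre` differentiates under the integral, and `continuousOn_integral_fibre`
makes the resulting integrals continuous by localising to charts of `G`, where the Haar system has a
continuous density.

For these arguments the uniform convergence in `CInfZeroOn` is replaced by the pointwise condition
`CInfZeroAt`: smooth slices whose derivatives are jointly continuous. On open sets with locally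
compact fibre space the two agree, and the pointwise form is easy to compose. -/

theorem eventually_slice_eventuallyEq {T E F : Type*} [TopologicalSpace T] [TopologicalSpace E]
    {f g : T × E → F} {z : T × E} (h : g =ᶠ[𝓝 z] f) :
    ∀ᶠ y in 𝓝 z, (fun w => g (y.1, w)) =ᶠ[𝓝 y.2] fun w => f (y.1, w) := by
  filter_upwards [eventually_eventually_nhds.2 h] with y hy
  exact ((Continuous.prodMk_right y.1).tendsto y.2).eventually hy

section Calculus

variable {T T' E F F' H : Type*} [TopologicalSpace T] [TopologicalSpace T']
  [NormedAddCommGroup E] [NormedSpace ℝ E] [NormedAddCommGroup F] [NormedSpace ℝ F]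
  [NormedAddCommGroup F'] [NormedSpace ℝ F'] [NormedAddCommGroup H] [NormedSpace ℝ H]

/-- `f` is `C^{∞,0}` at `z`: its slices are smooth near `z`, and all their derivatives are jointly
continuous at `z`. -/
def CInfZeroAt (f : T × E → F) (z : T × E) : Prop :=
  (∀ᶠ y in 𝓝 z, ContDiffAt ℝ ∞ (fun w => f (y.1, w)) y.2) ∧
    ∀ n : ℕ, ContinuousAt (fun y : T × E => iteratedFDeriv ℝ n (fun w => f (y.1, w)) y.2) z

theorem CInfZeroAt.continuousAt {f : T × E → F} {z : T × E} (hf : CInfZeroAt f z) :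
    ContinuousAt f z := by
  have h := (continuousMultilinearCurryFin0 ℝ E F).continuous.continuousAt.comp (hf.2 0)
  simpa [Function.comp_def, iteratedFDeriv_zero_eq_comp] using h

theorem CInfZeroAt.congr_of_eventuallyEq {f g : T × E → F} {z : T × E} (hf : CInfZeroAt f z)
    (h : g =ᶠ[𝓝 z] f) : CInfZeroAt g z := by
  have key := eventually_slice_eventuallyEq h
  refine ⟨?_, fun n => (hf.2 n).congr ?_⟩
  · filter_upwards [hf.1, key] with y h1 h2 using h1.congr_of_eventuallyEq h2
  · filter_upwards [key] with y h2 using ((h2.iteratedFDeriv ℝ n).eq_of_nhds).symm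

/-- On a compact neighbourhood in the slice, the derivatives of nearby slices are uniformly close to
those of the slice through `z`, which are themselves continuous. An `ε / 2` argument then gives
joint continuity. -/
theorem CInfZeroOn.cInfZeroAt [LocallyCompactSpace E] {f : T × E → F} {U : Set (T × E)}
    (hf : CInfZeroOn f U) (hU : IsOpen U) {z : T × E} (hz : z ∈ U) : CInfZeroAt f z := by
  have hsl (t : T) : IsOpen {w | (t, w) ∈ U} := hU.preimage (Continuous.prodMk_right t)
  have hsm : ∀ y ∈ U, ContDiffAt ℝ ∞ (fun w => f (y.1, w)) y.2 := fun y hy =>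
    (hf y.1).1.contDiffAt ((hsl y.1).mem_nhds hy)
  refine ⟨by filter_upwards [hU.mem_nhds hz] with y hy using hsm y hy, fun n => ?_⟩
  obtain ⟨K, hK, hKU, hKc⟩ := local_compact_nhds ((hsl z.1).mem_nhds (show z.2 ∈ _ from hz))
  have h1 := (hf z.1).2 n K hKc hKU
  have hc : ContinuousAt (iteratedFDeriv ℝ n (fun v => f (z.1, v))) z.2 :=
    (hsm z hz).continuousAt_iteratedFDeriv (mod_cast le_top)
  have h2 : TendstoUniformlyOnFilter
      (fun (t' : T) (w : E) => iteratedFDeriv ℝ n (fun v => f (t', v)) w)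
      (iteratedFDeriv ℝ n (fun v => f (z.1, v))) (𝓝 z.1) (𝓝 z.2) :=
    h1.tendstoUniformlyOnFilter.mono_right (le_principal_iff.2 hK)
  rw [ContinuousAt, Metric.tendsto_nhds]
  intro ε hε
  rw [Metric.tendstoUniformlyOnFilter_iff] at h2
  have h3 := h2 (ε / 2) (half_pos hε)
  have h4 : ∀ᶠ y : T × E in 𝓝 z, dist (iteratedFDeriv ℝ n (fun v => f (z.1, v)) y.2)
      (iteratedFDeriv ℝ n (fun v => f (z.1, v)) z.2) < ε / 2 :=
    (hc.comp (f := Prod.snd) continuousAt_snd).eventually (Metric.ball_mem_nhds _ (half_pos hε))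
  rw [← nhds_prod_eq] at h3
  filter_upwards [h3, h4] with y h3 h4
  have := dist_triangle_left (iteratedFDeriv ℝ n (fun v => f (y.1, v)) y.2)
    (iteratedFDeriv ℝ n (fun v => f (z.1, v)) z.2)
    (iteratedFDeriv ℝ n (fun v => f (z.1, v)) y.2)
  linarith

/-- A jointly continuous function converges uniformly on a compact set as the parameter varies. The
tube lemma supplies a neighbourhood `u` of `t` with `u ×ˢ K` inside `U`. -/
theorem cInfZeroOn_of_forall_cInfZeroAt {f : T × E → F} {U : Set (T × E)} (hU : IsOpen U)
    (hf : ∀ z ∈ U, CInfZeroAt f z) : CInfZeroOn f U := by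
  refine fun t => ⟨fun w hw => ((hf _ hw).1.self_of_nhds).contDiffWithinAt, fun n K hK hKU => ?_⟩
  obtain ⟨u, v, hu, _, htu, hKv, huv⟩ := generalized_tube_lemma (s := {t}) (t := K)
    isCompact_singleton hK hU (by
      rintro ⟨a, b⟩ ⟨ha, hb⟩
      obtain rfl : a = t := ha
      exact hKU hb)
  have hcont : ContinuousOn (Function.uncurry
      fun (t' : T) (w : E) => iteratedFDeriv ℝ n (fun v => f (t', v)) w) (u ×ˢ K) :=
    fun y hy => ((hf y (huv ⟨hy.1, hKv hy.2⟩)).2 n).continuousWithinAt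
  intro W hW
  obtain ⟨N, hN, hNW⟩ := hK.mem_uniformity_of_prod hcont (htu rfl) (UniformSpace.symm hW)
  rw [hu.nhdsWithin_eq (htu rfl)] at hN
  filter_upwards [hN] with t' ht' w hw using hNW t' ht' w hw

/-- Composition of `C^{∞,0}` maps, with a change of the parameter. -/
theorem CInfZeroAt.comp {h : T' × F → H} {f : T × E → F} {q : T → T'} {z : T × E}
    (hh : CInfZeroAt h (q z.1, f z)) (hf : CInfZeroAt f z) (hq : ContinuousAt q z.1) :
    CInfZeroAt (fun y => h (q y.1, f y)) z := by
  have hc : ContinuousAt (fun y : T × E => (q y.1, f y)) z :=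
    (hq.comp continuousAt_fst).prodMk hf.continuousAt
  have hev : ∀ᶠ y in 𝓝 z, ContDiffAt ℝ ∞ (fun w => h (q y.1, w)) (f y) := hc.eventually hh.1
  refine ⟨?_, fun n => ?_⟩
  · filter_upwards [hev, hf.1] with y h1 h2 using
      ContDiffAt.comp (g := fun w => h (q y.1, w)) (f := fun w => f (y.1, w)) y.2 h1 h2
  -- Faà di Bruno's formula: the `n`-th derivative is a finite sum of multilinear expressions in the
  -- derivatives of `h` and `f`, each jointly continuous.
  have hD : ∀ᶠ y in 𝓝 z, (∑ c : OrderedFinpartition n,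
        c.compAlongOrderedFinpartitionL ℝ E F H
          (iteratedFDeriv ℝ c.length (fun w => h (q y.1, w)) (f y))
          (fun i => iteratedFDeriv ℝ (c.partSize i) (fun w => f (y.1, w)) y.2)) =
      iteratedFDeriv ℝ n (fun w => h (q y.1, f (y.1, w))) y.2 := by
    filter_upwards [hev, hf.1] with y h1 h2
    have := iteratedFDeriv_comp (x := y.2) (g := fun w => h (q y.1, w))
      (f := fun w => f (y.1, w)) h1 h2 (i := n) (mod_cast le_top)
    exact this.symm
  refine ContinuousAt.congr ?_ hD
  refine tendsto_finsetSum _ fun c _ => ?_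
  have hA : ContinuousAt (fun y : T × E =>
      c.compAlongOrderedFinpartitionL ℝ E F H
        (iteratedFDeriv ℝ c.length (fun w => h (q y.1, w)) (f y))) z :=
    (c.compAlongOrderedFinpartitionL ℝ E F H).continuous.continuousAt.comp
      ((hh.2 c.length).comp (f := fun y : T × E => (q y.1, f y)) hc)
  have hB : ContinuousAt (fun (y : T × E) i =>
      iteratedFDeriv ℝ (c.partSize i) (fun w => f (y.1, w)) y.2) z :=
    continuousAt_pi.2 fun i => hf.2 _
  have hev : Continuous fun a : (ContinuousMultilinearMap ℝ
      (fun i : Fin c.length => E [×c.partSize i]→L[ℝ] F) (E [×n]→L[ℝ] H)) ×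
      (∀ i : Fin c.length, E [×c.partSize i]→L[ℝ] F) => a.1 a.2 := by
    fun_prop
  exact hev.continuousAt.comp (hA.prodMk hB)

theorem CInfZeroAt.baseChange {f : T' × E → F} {q : T → T'} {z : T × E}
    (hf : CInfZeroAt f (q z.1, z.2)) (hq : ContinuousAt q z.1) :
    CInfZeroAt (fun y => f (q y.1, y.2)) z := by
  have hc : ContinuousAt (fun y : T × E => (q y.1, y.2)) z :=
    (hq.comp continuousAt_fst).prodMk continuousAt_snd
  exact ⟨hc.eventually hf.1, fun n => (hf.2 n).comp (f := fun y : T × E => (q y.1, y.2)) hc⟩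

theorem CInfZeroAt.of_contDiffAt {f : E → F} {z : T × E}
    (hf : ∀ᶠ w in 𝓝 z.2, ContDiffAt ℝ ∞ f w) : CInfZeroAt (fun y : T × E => f y.2) z :=
  ⟨continuousAt_snd.eventually hf, fun _ =>
    (hf.self_of_nhds.continuousAt_iteratedFDeriv (mod_cast le_top)).comp continuousAt_snd⟩

theorem ContDiff.cInfZeroAt {f : E → F} (hf : ContDiff ℝ ∞ f) (z : T × E) :
    CInfZeroAt (fun y : T × E => f y.2) z :=
  .of_contDiffAt (.of_forall fun _ => hf.contDiffAt)

theorem CInfZeroAt.of_continuousAt_fst {f : T → F} {z : T × E}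
    (hf : ContinuousAt f z.1) : CInfZeroAt (fun y : T × E => f y.1) z := by
  refine ⟨.of_forall fun y => contDiffAt_const (c := f y.1), fun n => ?_⟩
  rcases n with _ | n
  · simp only [iteratedFDeriv_zero_eq_comp]
    exact (continuousMultilinearCurryFin0 ℝ E F).symm.continuous.continuousAt.comp
      (hf.comp continuousAt_fst)
  · simp only [iteratedFDeriv_succ_const]
    exact continuousAt_const

theorem CInfZeroAt.prodMk {f : T × E → F} {g : T × E → F'} {z : T × E}
    (hf : CInfZeroAt f z) (hg : CInfZeroAt g z) : CInfZeroAt (fun y => (f y, g y)) z := by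
  refine ⟨by filter_upwards [hf.1, hg.1] with y h1 h2 using h1.prodMk h2, fun n => ?_⟩
  have hD : ∀ᶠ y in 𝓝 z,
      (iteratedFDeriv ℝ n (fun w => f (y.1, w)) y.2).prod
        (iteratedFDeriv ℝ n (fun w => g (y.1, w)) y.2) =
      iteratedFDeriv ℝ n (fun w => (f (y.1, w), g (y.1, w))) y.2 := by
    filter_upwards [hf.1, hg.1] with y h1 h2
    exact (iteratedFDeriv_prodMk h1 h2 (mod_cast le_top)).symm
  refine ContinuousAt.congr ?_ hD
  exact (ContinuousMultilinearMap.prodL ℝ (fun _ : Fin n => E) F F').continuous.continuousAt.comp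
    ((hf.2 n).prodMk (hg.2 n))

/-- Postcomposition with a map that is smooth near the value. -/
theorem CInfZeroAt.contDiffAt_comp {h : F → H} {f : T × E → F} {z : T × E}
    (hf : CInfZeroAt f z) (hh : ∀ᶠ w in 𝓝 (f z), ContDiffAt ℝ ∞ h w) :
    CInfZeroAt (fun y => h (f y)) z :=
  CInfZeroAt.comp (h := fun y : T × F => h y.2) (q := id)
    (CInfZeroAt.of_contDiffAt hh) hf continuousAt_id

theorem CInfZeroAt.smul {f : T × E → ℝ} {g : T × E → F} {z : T × E}
    (hf : CInfZeroAt f z) (hg : CInfZeroAt g z) : CInfZeroAt (fun y => f y • g y) z :=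
  (hf.prodMk hg).contDiffAt_comp (h := fun a : ℝ × F => a.1 • a.2)
    (.of_forall fun _ => (contDiff_fst.smul contDiff_snd).contDiffAt)

theorem CInfZeroAt.add {f g : T × E → F} {z : T × E}
    (hf : CInfZeroAt f z) (hg : CInfZeroAt g z) : CInfZeroAt (fun y => f y + g y) z :=
  (hf.prodMk hg).contDiffAt_comp (h := fun a : F × F => a.1 + a.2)
    (.of_forall fun _ => (contDiff_fst.add contDiff_snd).contDiffAt)

theorem CInfZeroAt.inv {f : T × E → ℝ} {z : T × E}
    (hf : CInfZeroAt f z) (h0 : f z ≠ 0) : CInfZeroAt (fun y => (f y)⁻¹) z :=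
  hf.contDiffAt_comp (h := fun a : ℝ => a⁻¹)
    ((isOpen_ne.eventually_mem h0).mono fun _ hw => contDiffAt_inv ℝ hw)

end Calculus

/-! ### Smooth functions on continuous families -/

namespace ContFamily

section Smooth

variable {T X F : Type*} [TopologicalSpace T] [TopologicalSpace X] {p : X → T}
  [NormedAddCommGroup F] [NormedSpace ℝ F]

/-- The function `h` on the total space of a family is `C^{∞,0}` in all charts. -/
def IsSmooth (𝓧 : ContFamily p) (h : X → F) : Prop :=
  ∀ φ ∈ 𝓧.atlas, ∀ z ∈ φ.target, CInfZeroAt (fun y => h (φ.symm y)) z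

theorem IsSmooth.continuous {𝓧 : ContFamily p} {h : X → F} (hh : 𝓧.IsSmooth h) :
    Continuous h := by
  refine continuous_iff_continuousAt.2 fun x => ?_
  obtain ⟨φ, hφ, hx⟩ := 𝓧.cover x
  have h1 := (hh φ hφ (φ x) (φ.map_source hx)).continuousAt.comp (φ.continuousAt hx)
  refine h1.congr ?_
  filter_upwards [φ.open_source.mem_nhds hx] with y hy
  simp [φ.left_inv hy]

theorem isMorphism_id (𝓧 : ContFamily p) : 𝓧.IsMorphism 𝓧 id id where
  continuous_map := continuous_id
  continuous_base := continuous_id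
  comm _ := rfl
  cInfZero := 𝓧.compatible

section Morphism

variable {T₁ X₁ T₂ X₂ : Type*} [TopologicalSpace T₁] [TopologicalSpace X₁]
  [TopologicalSpace T₂] [TopologicalSpace X₂] {p₁ : X₁ → T₁} {p₂ : X₂ → T₂}
  {𝓧₁ : ContFamily p₁} {𝓧₂ : ContFamily p₂} {f : X₁ → X₂} {q : T₁ → T₂}

/-- In charts `f` has first component `q` and a `C^{∞,0}` second component, so `CInfZeroAt.comp`
applies. A single chart `ψ` around the image point suffices. -/
theorem IsMorphism.cInfZeroAt_comp (hf : 𝓧₁.IsMorphism 𝓧₂ f q) {h : X₂ → F}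
    {φ : OpenPartialHomeomorph X₁ (T₁ × EuclideanSpace ℝ (Fin 𝓧₁.dim))} (hφ : φ ∈ 𝓧₁.atlas)
    {z : T₁ × EuclideanSpace ℝ (Fin 𝓧₁.dim)} (hz : z ∈ φ.target)
    {ψ : OpenPartialHomeomorph X₂ (T₂ × EuclideanSpace ℝ (Fin 𝓧₂.dim))} (hψ : ψ ∈ 𝓧₂.atlas)
    (hzψ : f (φ.symm z) ∈ ψ.source)
    (hh : CInfZeroAt (fun y => h (ψ.symm y)) (ψ (f (φ.symm z)))) :
    CInfZeroAt (fun y => h (f (φ.symm y))) z := by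
  have hO : IsOpen (φ.target ∩ φ.symm ⁻¹' (f ⁻¹' ψ.source)) :=
    φ.symm.isOpen_inter_preimage (ψ.open_source.preimage hf.continuous_map)
  have h1 := (hf.cInfZero φ hφ ψ hψ).cInfZeroAt hO ⟨hz, hzψ⟩
  have key : ∀ y ∈ φ.target ∩ φ.symm ⁻¹' (f ⁻¹' ψ.source),
      ψ (f (φ.symm y)) = (q y.1, (ψ (f (φ.symm y))).2) := fun y hy => by
    refine Prod.ext ?_ rfl
    rw [𝓧₂.fibre_preserving ψ hψ _ hy.2, hf.comm, 𝓧₁.proj_symm hφ hy.1]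
  rw [key z ⟨hz, hzψ⟩] at hh
  refine (CInfZeroAt.comp (h := fun y => h (ψ.symm y)) hh h1
    hf.continuous_base.continuousAt).congr_of_eventuallyEq ?_
  filter_upwards [hO.mem_nhds ⟨hz, hzψ⟩] with y hy
  rw [← key y hy, ψ.left_inv hy.2]

theorem IsSmooth.comp_morphism {h : X₂ → F} (hh : 𝓧₂.IsSmooth h)
    (hf : 𝓧₁.IsMorphism 𝓧₂ f q) : 𝓧₁.IsSmooth fun x => h (f x) := by
  intro φ hφ z hz
  obtain ⟨ψ, hψ, hx⟩ := 𝓧₂.cover (f (φ.symm z))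
  exact hf.cInfZeroAt_comp hφ hz hψ hx (hh ψ hψ _ (ψ.map_source hx))

end Morphism

/-- It suffices to check smoothness in one chart around each point. -/
theorem isSmooth_of_exists_chart {𝓧 : ContFamily p} {h : X → F}
    (hh : ∀ x, ∃ φ ∈ 𝓧.atlas, x ∈ φ.source ∧ CInfZeroAt (fun y => h (φ.symm y)) (φ x)) :
    𝓧.IsSmooth h := by
  intro φ hφ z hz
  obtain ⟨ψ, hψ, hx, hs⟩ := hh (φ.symm z)
  -- Compatibility of charts says that the identity is a morphism, so this is a change of charts.
  exact 𝓧.isMorphism_id.cInfZeroAt_comp hφ hz hψ hx hs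

theorem isSmooth_zero (𝓧 : ContFamily p) : 𝓧.IsSmooth fun _ => (0 : F) := fun _ _ _ _ =>
  .of_continuousAt_fst (f := fun _ => (0 : F)) continuousAt_const

theorem IsSmooth.add {𝓧 : ContFamily p} {f g : X → F} (hf : 𝓧.IsSmooth f) (hg : 𝓧.IsSmooth g) :
    𝓧.IsSmooth fun x => f x + g x :=
  fun φ hφ z hz => (hf φ hφ z hz).add (hg φ hφ z hz)

/-- Bump functions in the charts. -/
theorem exists_isSmooth_pos_at [T2Space T] [LocallyCompactSpace T] [T2Space X]
    (𝓧 : ContFamily p) (x₀ : X) :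
    ∃ b : X → ℝ, 𝓧.IsSmooth b ∧ HasCompactSupport b ∧ (∀ x, 0 ≤ b x) ∧ 0 < b x₀ := by
  classical
  obtain ⟨φ, hφ, hx₀⟩ := 𝓧.cover x₀
  obtain ⟨A, V, hA, hV, htA, hwV, hAV⟩ :=
    isOpen_prod_iff.1 φ.open_target (φ x₀).1 (φ x₀).2 (φ.map_source hx₀)
  obtain ⟨K, hKc, hKA, hKA'⟩ := exists_compact_subset hA htA
  -- Only continuity is required in the direction of `T`, so a Urysohn function serves there; a
  -- smooth bump is used along the fibre.
  obtain ⟨χ, hχ1, hχ0, -, hχr⟩ := exists_continuous_one_zero_of_isCompact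
    (isCompact_singleton (x := (φ x₀).1)) (isOpen_interior (s := K)).isClosed_compl
    (disjoint_compl_right_iff_subset.2 (singleton_subset_iff.2 hKA))
  obtain ⟨ε, hε, hεV⟩ := Metric.nhds_basis_closedBall.mem_iff.1 (hV.mem_nhds hwV)
  let β : ContDiffBump (φ x₀).2 := ⟨ε / 2, ε, half_pos hε, half_lt_self hε⟩
  let b : X → ℝ := fun x => if x ∈ φ.source then χ (φ x).1 * β (φ x).2 else 0
  let Q := K ×ˢ Metric.closedBall (φ x₀).2 ε
  have hQ : IsCompact Q := hKc.prod (isCompact_closedBall _ _)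
  have hQt : Q ⊆ φ.target := (prod_mono hKA' hεV).trans hAV
  have hS : IsCompact (φ.symm '' Q) := hQ.image_of_continuousOn (φ.symm.continuousOn.mono hQt)
  have hb0 : ∀ x, x ∉ φ.symm '' Q → b x = 0 := by
    intro x hx
    by_cases hxs : x ∈ φ.source
    · have hnQ : φ x ∉ Q := fun h => hx ⟨φ x, h, φ.left_inv hxs⟩
      simp only [b, if_pos hxs]
      rw [mem_prod, not_and_or] at hnQ
      rcases hnQ with h | h
      · rw [hχ0 (show (φ x).1 ∈ (interior K)ᶜ from fun h' => h (interior_subset h'))]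
        simp
      · have : β (φ x).2 = 0 := β.zero_of_le_dist (by
          rw [Metric.mem_closedBall, not_le] at h
          exact h.le)
        rw [this, mul_zero]
    · simp [b, hxs]
  refine ⟨b, isSmooth_of_exists_chart fun x => ?_, .intro hS hb0, fun x => ?_, ?_⟩
  · by_cases hxs : x ∈ φ.source
    · refine ⟨φ, hφ, hxs, ?_⟩
      have h1 : CInfZeroAt (fun y => χ y.1 • β y.2) (φ x) :=
        (CInfZeroAt.of_continuousAt_fst χ.continuous.continuousAt).smul
          (β.contDiff.cInfZeroAt _)
      refine h1.congr_of_eventuallyEq ?_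
      filter_upwards [φ.open_target.mem_nhds (φ.map_source hxs)] with y hy
      simp [b, φ.map_target hy, φ.right_inv hy]
    · obtain ⟨ψ, hψ, hxψ⟩ := 𝓧.cover x
      refine ⟨ψ, hψ, hxψ, ((isSmooth_zero (F := ℝ) 𝓧) ψ hψ _
        (ψ.map_source hxψ)).congr_of_eventuallyEq ?_⟩
      -- The support of `b` lies in the compact, hence closed, set `φ.symm '' Q` inside the chart
      -- domain, so `b` vanishes near every point outside that domain.
      have hx : x ∉ φ.symm '' Q := by
        rintro ⟨y, hy, rfl⟩
        exact hxs (φ.map_target (hQt hy))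
      have hc : Tendsto ψ.symm (𝓝 (ψ x)) (𝓝 x) := by
        have := ψ.symm.continuousAt (ψ.map_source hxψ)
        rwa [ContinuousAt, ψ.left_inv hxψ] at this
      filter_upwards [hc.eventually (hS.isClosed.isOpen_compl.mem_nhds hx)] with y hy
      exact hb0 _ hy
  · by_cases hxs : x ∈ φ.source
    · simp only [b, if_pos hxs]
      exact mul_nonneg (hχr _).1 β.nonneg
    · simp [b, hxs]
  · simp only [b, if_pos hx₀, hχ1 (mem_singleton _), Pi.one_apply, one_mul]
    exact β.pos_of_mem_ball (Metric.mem_ball_self hε)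

/-- Positivity at a point persists on a neighbourhood, and non-negative functions can be added, so
compactness reduces the claim to single points. -/
theorem exists_isSmooth_pos_on [T2Space T] [LocallyCompactSpace T] [T2Space X]
    (𝓧 : ContFamily p) {C : Set X} (hC : IsCompact C) :
    ∃ b : X → ℝ, 𝓧.IsSmooth b ∧ HasCompactSupport b ∧ (∀ x, 0 ≤ b x) ∧ ∀ x ∈ C, 0 < b x := by
  refine hC.induction_on (p := fun C => ∃ b : X → ℝ, 𝓧.IsSmooth b ∧ HasCompactSupport b ∧
    (∀ x, 0 ≤ b x) ∧ ∀ x ∈ C, 0 < b x) ?_ (fun s t hst ht => ?_) (fun s t hs ht => ?_)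
    (fun x _ => ?_)
  · exact ⟨_, 𝓧.isSmooth_zero, HasCompactSupport.zero, fun _ => le_rfl, by simp⟩
  · obtain ⟨b, h1, h2, h3, h4⟩ := ht
    exact ⟨b, h1, h2, h3, fun x hx => h4 x (hst hx)⟩
  · obtain ⟨b, h1, h2, h3, h4⟩ := hs
    obtain ⟨b', h1', h2', h3', h4'⟩ := ht
    refine ⟨_, h1.add h1', h2.add h2', fun x => add_nonneg (h3 x) (h3' x), ?_⟩
    rintro x (hx | hx)
    · exact add_pos_of_pos_of_nonneg (h4 x hx) (h3' x)
    · exact add_pos_of_nonneg_of_pos (h3 x) (h4' x hx)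
  · obtain ⟨b, h1, h2, h3, h4⟩ := 𝓧.exists_isSmooth_pos_at x
    exact ⟨{y | 0 < b y}, nhdsWithin_le_nhds
      ((isOpen_lt continuous_const h1.continuous).mem_nhds h4), b, h1, h2, h3, fun y hy => hy⟩

variable {Z : Type*} [TopologicalSpace Z]

theorem pullbackChart_symm_apply (𝓧 : ContFamily p) {t : Z → T} (ht : Continuous t)
    {φ : OpenPartialHomeomorph X (T × EuclideanSpace ℝ (Fin 𝓧.dim))} (hφ : φ ∈ 𝓧.atlas)
    {b : Z × EuclideanSpace ℝ (Fin 𝓧.dim)} (hb : (t b.1, b.2) ∈ φ.target) :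
    (𝓧.pullbackChart ht φ hφ).symm b =
      ⟨(b.1, φ.symm (t b.1, b.2)), (𝓧.proj_symm hφ hb).symm⟩ :=
  dif_pos hb

end Smooth

end ContFamily

/-! ### Integration along the fibres -/

namespace ContFamilyGroupoid

section Fibre

variable {B G V F : Type*} [TopologicalSpace B] [TopologicalSpace G]
  {𝓖 : ContFamilyGroupoid B G}

theorem isCompact_fibre_preimage [T2Space B] (𝓖 : ContFamilyGroupoid B G) {K : Set G}
    (hK : IsCompact K) (u : B) : IsCompact (Subtype.val ⁻¹' K : Set {g : G // 𝓖.r g = u}) :=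
  ((isClosed_singleton.preimage 𝓖.continuous_r).isClosedEmbedding_subtypeVal :
    Topology.IsClosedEmbedding (Subtype.val : {g : G // 𝓖.r g = u} → G)).isCompact_preimage hK

theorem continuous_fibre [TopologicalSpace V] [TopologicalSpace F] {W : Set (B × V)} {f : G × V → F}
    (hf : ContinuousOn f {y | (𝓖.r y.1, y.2) ∈ W}) {b : B × V} (hb : b ∈ W) :
    Continuous fun g : {g : G // 𝓖.r g = b.1} => f (g.1, b.2) :=
  hf.comp_continuous (by fun_prop) fun g => by simpa [g.2] using hb

theorem hasCompactSupport_fibre [T2Space B] [T2Space G] [Zero F] {W : Set (B × V)} {f : G × V → F}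
    {K : Set G} (hK : IsCompact K)
    (hfK : ∀ y : G × V, (𝓖.r y.1, y.2) ∈ W → y.1 ∉ K → f y = 0) {b : B × V} (hb : b ∈ W) :
    HasCompactSupport fun g : {g : G // 𝓖.r g = b.1} => f (g.1, b.2) :=
  .intro (𝓖.isCompact_fibre_preimage hK b.1) fun g hg =>
    hfK (g.1, b.2) (by simpa [g.2] using hb) hg

end Fibre

section Integral

variable {B G : Type*} [TopologicalSpace B] [TopologicalSpace G]
  [MeasurableSpace G] [BorelSpace G] {𝓖 : ContFamilyGroupoid B G}
  {lam : (u : B) → Measure {g : G // 𝓖.r g = u}}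
  {F : Type*} [NormedAddCommGroup F] [NormedSpace ℝ F]

/-- The integral over a fibre of a function supported in a chart. -/
theorem integral_fibre_eq_integral_chart [SecondCountableTopology G]
    {φ : OpenPartialHomeomorph G (B × EuclideanSpace ℝ (Fin 𝓖.famR.dim))}
    (hφ : φ ∈ 𝓖.famR.atlas) {d : B × EuclideanSpace ℝ (Fin 𝓖.famR.dim) → ℝ≥0}
    (hd : ContinuousOn d φ.target)
    (hmap : ∀ u ∈ 𝓖.r '' φ.source,
      ((lam u).restrict {g | g.1 ∈ φ.source}).map (fun g => (φ g.1).2) =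
        (volume.restrict {w | (u, w) ∈ φ.target}).withDensity (fun w => (d (u, w) : ℝ≥0∞)))
    {u : B} {k : G → F} (hk : ∀ g, 𝓖.r g = u → g ∉ φ.source → k g = 0)
    (hkc : ContinuousOn (fun w => k (φ.symm (u, w))) {w | (u, w) ∈ φ.target}) :
    ∫ g : {g : G // 𝓖.r g = u}, k g.1 ∂(lam u) =
      ∫ w, indicator {w | (u, w) ∈ φ.target} (fun w => d (u, w) • k (φ.symm (u, w))) w := by
  have hO : IsOpen {w | (u, w) ∈ φ.target} := φ.open_target.preimage (Continuous.prodMk_right u)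
  by_cases hu : u ∈ 𝓖.r '' φ.source
  · have hS : MeasurableSet {g : {g : G // 𝓖.r g = u} | g.1 ∈ φ.source} :=
      (φ.open_source.preimage continuous_subtype_val).measurableSet
    have hφc : ContinuousOn (fun g : {g : G // 𝓖.r g = u} => (φ g.1).2) {g | g.1 ∈ φ.source} :=
      continuous_snd.comp_continuousOn
        (φ.continuousOn.comp continuous_subtype_val.continuousOn fun _ h => h)
    have hdu : AEMeasurable (fun w => d (u, w)) (volume.restrict {w | (u, w) ∈ φ.target}) :=
      (hd.comp (Continuous.prodMk_right u).continuousOn fun _ h => h).aemeasurable hO.measurableSet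
    calc ∫ g : {g : G // 𝓖.r g = u}, k g.1 ∂(lam u)
        = ∫ g in {g : {g : G // 𝓖.r g = u} | g.1 ∈ φ.source}, k g.1 ∂(lam u) :=
          (setIntegral_eq_integral_of_forall_compl_eq_zero fun g hg => hk g.1 g.2 hg).symm
      _ = ∫ g in {g : {g : G // 𝓖.r g = u} | g.1 ∈ φ.source},
            k (φ.symm (u, (φ g.1).2)) ∂(lam u) := by
          refine setIntegral_congr_fun hS fun g hg => ?_
          have : (u, (φ g.1).2) = φ g.1 :=
            Prod.ext ((𝓖.famR.fibre_preserving φ hφ g.1 hg).trans g.2).symm rfl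
          simp only [this, φ.left_inv hg]
      _ = ∫ w, k (φ.symm (u, w)) ∂((lam u).restrict {g | g.1 ∈ φ.source}).map
            (fun g => (φ g.1).2) := by
          refine (integral_map (f := fun w => k (φ.symm (u, w))) (hφc.aemeasurable hS) ?_).symm
          rw [hmap u hu]
          exact (hkc.aestronglyMeasurable hO.measurableSet).mono_ac
            (withDensity_absolutelyContinuous _ _)
      _ = _ := by
          rw [hmap u hu, integral_withDensity_eq_integral_smul₀ hdu, integral_indicator
            hO.measurableSet]
  · have h1 : ∀ g : {g : G // 𝓖.r g = u}, k g.1 = 0 := fun g =>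
      hk g.1 g.2 fun h => hu ⟨g.1, h, g.2⟩
    -- The chart target is a product `r(U) × V`, so its slice over `u ∉ r(U)` is empty and both
    -- integrals vanish.
    obtain ⟨V, -, hV⟩ := 𝓖.famR.target_eq φ hφ
    have h2 : {w | (u, w) ∈ φ.target} = ∅ := by
      ext w
      simp only [hV, mem_ofPred_eq, mem_empty_iff_false, iff_false]
      exact fun h => hu h.1
    simp [h1, h2]

variable {V : Type*} [TopologicalSpace V]

/-- In the chart the moving fibre becomes a fixed Euclidean space with Lebesgue measure. The
integrand, extended by zero, is jointly continuous and supported in a fixed compact set. -/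
theorem continuousOn_integral_fibre_of_chart [T2Space B] [SecondCountableTopology G]
    [FirstCountableTopology B] [FirstCountableTopology V]
    (hlam : 𝓖.IsContinuousLeftHaarSystem lam)
    {φ : OpenPartialHomeomorph G (B × EuclideanSpace ℝ (Fin 𝓖.famR.dim))}
    (hφ : φ ∈ 𝓖.famR.atlas) {χ : G → ℝ} (hχ : Continuous χ) (hχc : HasCompactSupport χ)
    (hχφ : tsupport χ ⊆ φ.source) {W : Set (B × V)} (hW : IsOpen W) {f : G × V → F}
    (hf : ContinuousOn f {y | (𝓖.r y.1, y.2) ∈ W}) :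
    ContinuousOn (fun b : B × V => ∫ g : {g : G // 𝓖.r g = b.1}, χ g.1 • f (g.1, b.2) ∂(lam b.1))
      W := by
  obtain ⟨d, hd, hmap⟩ := hlam.density φ hφ
  have hχ0 : ∀ g, g ∉ tsupport χ → χ g = 0 := fun g => image_eq_zero_of_notMem_tsupport
  have hO : IsOpen {a : (B × V) × EuclideanSpace ℝ (Fin 𝓖.famR.dim) |
      a.1 ∈ W ∧ (a.1.1, a.2) ∈ φ.target} :=
    (hW.preimage continuous_fst).inter (φ.open_target.preimage (by fun_prop))
  have hcont : ContinuousOn (fun a : (B × V) × EuclideanSpace ℝ (Fin 𝓖.famR.dim) =>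
      d (a.1.1, a.2) • χ (φ.symm (a.1.1, a.2)) • f (φ.symm (a.1.1, a.2), a.1.2))
      {a | a.1 ∈ W ∧ (a.1.1, a.2) ∈ φ.target} := by
    have hp : ContinuousOn (fun a : (B × V) × EuclideanSpace ℝ (Fin 𝓖.famR.dim) =>
        φ.symm (a.1.1, a.2)) {a | a.1 ∈ W ∧ (a.1.1, a.2) ∈ φ.target} :=
      φ.symm.continuousOn.comp
        (by fun_prop : Continuous fun a : (B × V) × EuclideanSpace ℝ (Fin 𝓖.famR.dim) =>
          (a.1.1, a.2)).continuousOn fun a ha => ha.2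
    have hdc : ContinuousOn (fun a : (B × V) × EuclideanSpace ℝ (Fin 𝓖.famR.dim) =>
        d (a.1.1, a.2)) {a | a.1 ∈ W ∧ (a.1.1, a.2) ∈ φ.target} :=
      hd.comp (by fun_prop : Continuous fun a : (B × V) × EuclideanSpace ℝ (Fin 𝓖.famR.dim) =>
        (a.1.1, a.2)).continuousOn fun a ha => ha.2
    refine hdc.smul ((hχ.comp_continuousOn hp).smul
      (hf.comp (hp.prodMk (by fun_prop)) fun a ha => ?_))
    simpa [𝓖.famR.proj_symm hφ ha.2] using ha.1
  have key : ContinuousOn (fun b : B × V => ∫ w, indicator {w | (b.1, w) ∈ φ.target}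
      (fun w => d (b.1, w) • χ (φ.symm (b.1, w)) • f (φ.symm (b.1, w), b.2)) w) W := by
    have hQ : IsCompact (φ '' tsupport χ) := hχc.isCompact.image_of_continuousOn
      (φ.continuousOn.mono hχφ)
    have hnot : ∀ (b : B × V) w, (b.1, w) ∉ φ '' tsupport χ → indicator {w | (b.1, w) ∈ φ.target}
        (fun w => d (b.1, w) • χ (φ.symm (b.1, w)) • f (φ.symm (b.1, w), b.2)) w = 0 := by
      intro b w hw
      by_cases ht : (b.1, w) ∈ φ.target
      · rw [indicator_of_mem (show w ∈ {w | (b.1, w) ∈ φ.target} from ht), hχ0, zero_smul, smul_zero]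
        exact fun h => hw ⟨_, h, φ.right_inv ht⟩
      · exact indicator_of_notMem (show w ∉ {w | (b.1, w) ∈ φ.target} from ht) _
    refine continuousOn_integral_of_compact_support (hQ.image continuous_snd) ?_ ?_
    · rintro ⟨b, w⟩ ⟨hb, -⟩
      refine ContinuousAt.continuousWithinAt ?_
      by_cases ht : (b.1, w) ∈ φ.target
      · refine (hcont.continuousAt (hO.mem_nhds ⟨hb, ht⟩)).congr ?_
        filter_upwards [hO.mem_nhds (show (b, w) ∈ _ from ⟨hb, ht⟩)] with a ha
        simp only [Function.uncurry_def]
        rw [indicator_of_mem (show a.2 ∈ {w | (a.1.1, w) ∈ φ.target} from ha.2)]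
      · have hn : (b.1, w) ∉ φ '' tsupport χ := by
          rintro ⟨g, hg, he⟩
          exact ht (he ▸ φ.map_source (hχφ hg))
        have hc : Continuous fun a : (B × V) × EuclideanSpace ℝ (Fin 𝓖.famR.dim) =>
          (a.1.1, a.2) := by fun_prop
        refine (continuousAt_const (y := (0 : F))).congr ?_
        filter_upwards [(hQ.isClosed.isOpen_compl.preimage hc).mem_nhds
          (show (b, w) ∈ _ from hn)] with a ha
        exact (hnot a.1 a.2 ha).symm
    · intro b w _ hw
      exact hnot b w fun h => hw ⟨_, h, rfl⟩
  refine key.congr fun b hb => ?_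
  refine integral_fibre_eq_integral_chart (k := fun g => χ g • f (g, b.2)) hφ hd hmap
    (fun g _ hg => ?_) ?_
  · rw [hχ0 g fun h => hg (hχφ h), zero_smul]
  · have hp : ContinuousOn (fun w => φ.symm (b.1, w)) {w | (b.1, w) ∈ φ.target} :=
      φ.symm.continuousOn.comp (by fun_prop) fun a ha => ha
    refine (hχ.comp_continuousOn hp).smul (hf.comp (hp.prodMk (by fun_prop)) fun w hw => ?_)
    simpa [𝓖.famR.proj_symm hφ hw] using hb

/-- A partition of unity on `K` subordinate to finitely many charts splits the integral into pieces
covered by `continuousOn_integral_fibre_of_chart`. -/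
theorem continuousOn_integral_fibre [T2Space B] [T2Space G] [LocallyCompactSpace G]
    [SecondCountableTopology G] [FirstCountableTopology B] [FirstCountableTopology V]
    (hlam : 𝓖.IsContinuousLeftHaarSystem lam) {W : Set (B × V)} (hW : IsOpen W) {f : G × V → F}
    (hf : ContinuousOn f {y | (𝓖.r y.1, y.2) ∈ W}) {K : Set G} (hK : IsCompact K)
    (hfK : ∀ y : G × V, (𝓖.r y.1, y.2) ∈ W → y.1 ∉ K → f y = 0) :
    ContinuousOn (fun b : B × V => ∫ g : {g : G // 𝓖.r g = b.1}, f (g.1, b.2) ∂(lam b.1)) W := by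
  choose φ hφ hgφ using 𝓖.famR.cover
  obtain ⟨t, ht⟩ := hK.elim_finite_subcover (fun g => (φ g).source) (fun g => (φ g).open_source)
    fun g _ => mem_iUnion.2 ⟨g, hgφ g⟩
  let e := t.equivFin
  obtain ⟨χ, hχφ, hχ1, -, hχc⟩ := exists_continuous_sum_one_of_isOpen_isCompact
    (s := fun i : Fin t.card => (φ (e.symm i).1).source) (fun i => (φ _).open_source) hK (by
      intro g hg
      obtain ⟨i, hi, hgi⟩ := mem_iUnion₂.1 (ht hg)
      exact mem_iUnion.2 ⟨e ⟨i, hi⟩, by simpa using hgi⟩)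
  have h1 : ContinuousOn (fun b : B × V => ∑ i, ∫ g : {g : G // 𝓖.r g = b.1},
      χ i g.1 • f (g.1, b.2) ∂(lam b.1)) W :=
    continuousOn_finsetSum _ fun i _ => continuousOn_integral_fibre_of_chart hlam (hφ _)
      (χ i).continuous (hχc i) (hχφ i) hW hf
  refine h1.congr fun b hb => ?_
  have := hlam.regular b.1
  simp only
  rw [← integral_finsetSum]
  · refine integral_congr_ae (.of_forall fun g => ?_)
    simp only
    rw [← Finset.sum_smul]
    by_cases hg : g.1 ∈ K
    · have := hχ1 hg
      simp only [Finset.sum_apply, Pi.one_apply] at this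
      rw [this, one_smul]
    · rw [hfK (g.1, b.2) (by simpa [g.2] using hb) hg, smul_zero]
  · intro i _
    exact (((χ i).continuous.comp continuous_subtype_val).smul
      (continuous_fibre hf hb)).integrable_of_hasCompactSupport
      (hasCompactSupport_fibre hK hfK hb).smul_left

end Integral

end ContFamilyGroupoid

/-! ### Smoothness of fibre integrals in a parameter. -/

namespace ContFamilyGroupoid

section Differentiation

variable {B G : Type*} [TopologicalSpace B] [TopologicalSpace G] [T2Space B] [T2Space G]
  [SecondCountableTopology G]
  [MeasurableSpace G] [BorelSpace G] {𝓖 : ContFamilyGroupoid B G}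
  {lam : (u : B) → Measure {g : G // 𝓖.r g = u}}
  {E F : Type*} [NormedAddCommGroup E] [NormedSpace ℝ E] [NormedAddCommGroup F] [NormedSpace ℝ F]

/-- Differentiation under the integral over a fibre. -/
theorem hasFDerivAt_integral_fibre (hlam : 𝓖.IsContinuousLeftHaarSystem lam)
    {W : Set (B × E)} (hW : IsOpen W) {f : G × E → F} {f' : G × E → E →L[ℝ] F}
    (hf : ContinuousOn f {y | (𝓖.r y.1, y.2) ∈ W})
    (hf' : ContinuousOn f' {y | (𝓖.r y.1, y.2) ∈ W})
    (hd : ∀ y : G × E, (𝓖.r y.1, y.2) ∈ W → HasFDerivAt (fun v => f (y.1, v)) (f' y) y.2)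
    {K : Set G} (hK : IsCompact K)
    (hfK : ∀ y : G × E, (𝓖.r y.1, y.2) ∈ W → y.1 ∉ K → f y = 0)
    (hfK' : ∀ y : G × E, (𝓖.r y.1, y.2) ∈ W → y.1 ∉ K → f' y = 0)
    {u : B} {v : E} (hv : (u, v) ∈ W) :
    HasFDerivAt (fun v => ∫ g : {g : G // 𝓖.r g = u}, f (g.1, v) ∂(lam u))
      (∫ g : {g : G // 𝓖.r g = u}, f' (g.1, v) ∂(lam u)) v := by
  have := hlam.regular u
  have : SecondCountableTopology {g : G // 𝓖.r g = u} :=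
    Topology.IsEmbedding.subtypeVal.secondCountableTopology
  have hWu : IsOpen {v | (u, v) ∈ W} := hW.preimage (Continuous.prodMk_right u)
  let k : Set {g : G // 𝓖.r g = u} := Subtype.val ⁻¹' K
  have hk : IsCompact k := 𝓖.isCompact_fibre_preimage hK u
  have hcu : ContinuousOn (Function.uncurry
      fun (v : E) (g : {g : G // 𝓖.r g = u}) => f' (g.1, v)) ({v | (u, v) ∈ W} ×ˢ k) := by
    refine hf'.comp (by fun_prop) fun a ha => ?_
    simpa [a.2.2] using ha.1
  -- For `v'` near `v` the derivative stays within `1` of its value at `v`, uniformly on the compact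
  -- `k`; this yields the dominating constant `M + 1`.
  obtain ⟨N, hN, hNk⟩ := hk.mem_uniformity_of_prod hcu hv (Metric.dist_mem_uniformity one_pos)
  rw [hWu.nhdsWithin_eq hv] at hN
  obtain ⟨M, hM⟩ := hk.exists_bound_of_continuousOn (continuous_fibre hf' hv).continuousOn
  refine hasFDerivAt_integral_of_dominated_of_fderiv_le (s := N ∩ {v | (u, v) ∈ W})
    (F := fun v (g : {g : G // 𝓖.r g = u}) => f (g.1, v))
    (F' := fun v (g : {g : G // 𝓖.r g = u}) => f' (g.1, v))
    (bound := indicator k fun _ => M + 1)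
    (inter_mem hN (hWu.mem_nhds hv)) ?_ ?_ ?_ ?_ ?_ ?_
  · filter_upwards [hWu.mem_nhds hv] with v' hv'
    have h1 : Continuous fun g : {g : G // 𝓖.r g = u} => f (g.1, v') := continuous_fibre hf hv'
    exact h1.aestronglyMeasurable
  · exact (continuous_fibre hf hv).integrable_of_hasCompactSupport
      (hasCompactSupport_fibre hK hfK hv)
  · have h1 : Continuous fun g : {g : G // 𝓖.r g = u} => f' (g.1, v) := continuous_fibre hf' hv
    exact h1.aestronglyMeasurable
  · refine .of_forall fun g v' hv' => ?_
    by_cases hg : g ∈ k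
    · rw [indicator_of_mem hg]
      have h1 := hNk v' hv'.1 g hg
      have h2 := hM g hg
      rw [mem_ofPred_eq, dist_eq_norm] at h1
      have h3 := norm_le_norm_add_norm_sub' (f' (g.1, v')) (f' (g.1, v))
      linarith
    · rw [indicator_of_notMem hg, hfK' (g.1, v') (by simpa [g.2] using hv'.2) hg, norm_zero]
  · exact (integrable_indicator_iff hk.measurableSet).2 (integrableOn_const hk.measure_ne_top)
  · refine .of_forall fun g v' hv' => hd (g.1, v') ?_
    simpa [g.2] using hv'.2

/-- Integration over the fibres preserves `C^{∞,0}` functions. -/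
theorem cInfZeroAt_integral_fibre [LocallyCompactSpace G] [FirstCountableTopology B]
    (hlam : 𝓖.IsContinuousLeftHaarSystem lam)
    {W : Set (B × E)} (hW : IsOpen W) {f : G × E → F}
    (hf : ∀ y : G × E, (𝓖.r y.1, y.2) ∈ W → CInfZeroAt f y)
    {K : Set G} (hK : IsCompact K)
    (hfK : ∀ y : G × E, (𝓖.r y.1, y.2) ∈ W → y.1 ∉ K → f y = 0) {b : B × E} (hb : b ∈ W) :
    CInfZeroAt (fun b : B × E => ∫ g : {g : G // 𝓖.r g = b.1}, f (g.1, b.2) ∂(lam b.1)) b := by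
  have hWu (u : B) : IsOpen {v | (u, v) ∈ W} := hW.preimage (Continuous.prodMk_right u)
  let D (n : ℕ) (y : G × E) : E [×n]→L[ℝ] F := iteratedFDeriv ℝ n (fun v => f (y.1, v)) y.2
  have hD (n : ℕ) : ContinuousOn (D n) {y | (𝓖.r y.1, y.2) ∈ W} := fun y hy =>
    ((hf y hy).2 n).continuousWithinAt
  have hsm (y : G × E) (hy : (𝓖.r y.1, y.2) ∈ W) : ContDiffAt ℝ ∞ (fun v => f (y.1, v)) y.2 :=
    (hf y hy).1.self_of_nhds
  have hDK (n : ℕ) (y : G × E) (hy : (𝓖.r y.1, y.2) ∈ W) (hyK : y.1 ∉ K) : D n y = 0 := by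
    -- For fixed `g ∉ K` the function vanishes on a whole neighbourhood in the slice, so its
    -- derivatives vanish too.
    have h0 : (fun v => f (y.1, v)) =ᶠ[𝓝 y.2] fun _ => 0 := by
      filter_upwards [(hWu (𝓖.r y.1)).mem_nhds hy] with v hv using hfK (y.1, v) hv hyK
    have := (h0.iteratedFDeriv ℝ n).eq_of_nhds
    simpa [D, iteratedFDeriv_fun_zero] using this
  let I (n : ℕ) (b : B × E) : E [×n]→L[ℝ] F :=
    ∫ g : {g : G // 𝓖.r g = b.1}, D n (g.1, b.2) ∂(lam b.1)
  have hI (n : ℕ) : ContinuousOn (I n) W := continuousOn_integral_fibre hlam hW (hD n) hK (hDK n)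
  have hDd (n : ℕ) (y : G × E) (hy : (𝓖.r y.1, y.2) ∈ W) :
      HasFDerivAt (fun v => D n (y.1, v)) (continuousMultilinearCurryLeftEquiv ℝ
        (fun _ : Fin (n + 1) => E) F (D (n + 1) y)) y.2 := by
    have h1 : DifferentiableAt ℝ (iteratedFDeriv ℝ n fun v => f (y.1, v)) y.2 :=
      (hsm y hy).differentiableAt_iteratedFDeriv (mod_cast WithTop.coe_lt_top _)
    have h2 := congrFun (fderiv_iteratedFDeriv (𝕜 := ℝ) (f := fun v => f (y.1, v)) (n := n)) y.2
    have h3 := h1.hasFDerivAt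
    rw [h2] at h3
    exact h3
  -- The integrals `I n` of the derivatives form a Taylor series of the integral; by uniqueness of
  -- such series on an open set they are its iterated derivatives, and they are jointly continuous
  -- by `hI`.
  have hT (u : B) : HasFTaylorSeriesUpToOn ∞
      (fun v => ∫ g : {g : G // 𝓖.r g = u}, f (g.1, v) ∂(lam u)) (fun v n => I n (u, v))
      {v | (u, v) ∈ W} := by
    refine ⟨fun v hv => ?_, fun n _ v hv => ?_, fun n _ => ?_⟩
    · have := (continuousMultilinearCurryFin0 ℝ E F).toContinuousLinearEquiv.integral_comp_comm
        (μ := lam u) fun g : {g : G // 𝓖.r g = u} => D 0 (g.1, v)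
      exact this.symm
    · refine HasFDerivAt.hasFDerivWithinAt ?_
      have h1 := hasFDerivAt_integral_fibre hlam hW (hD n)
        ((continuousMultilinearCurryLeftEquiv ℝ (fun _ : Fin (n + 1) => E)
          F).continuous.comp_continuousOn (hD (n + 1))) (hDd n) hK (hDK n)
        (fun y hy hyK => by
          simp only [Function.comp_apply, hDK (n + 1) y hy hyK]
          exact LinearIsometryEquiv.map_zero _) hv
      have h2 := ContinuousLinearEquiv.integral_comp_comm (𝕜 := ℝ)
        (E := E [×(n + 1)]→L[ℝ] F) (F := E →L[ℝ] E [×n]→L[ℝ] F)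
        (continuousMultilinearCurryLeftEquiv ℝ (fun _ : Fin (n + 1) => E)
          F).toContinuousLinearEquiv (μ := lam u) fun g : {g : G // 𝓖.r g = u} => D (n + 1) (g.1, v)
      exact h1.congr_fderiv h2
    · exact (hI n).comp (Continuous.prodMk_right u).continuousOn fun v hv => hv
  refine ⟨?_, fun n => ?_⟩
  · filter_upwards [hW.mem_nhds hb] with y hy
    exact (hT y.1).contDiffOn.contDiffAt ((hWu y.1).mem_nhds hy)
  · refine ((hI n).continuousAt (hW.mem_nhds hb)).congr ?_
    filter_upwards [hW.mem_nhds hb] with y hy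
    have h1 := (hT y.1).eq_iteratedFDerivWithin_of_uniqueDiffOn (m := n) (mod_cast le_top)
      (hWu y.1).uniqueDiffOn hy
    rw [iteratedFDerivWithin_of_isOpen n (hWu y.1) hy] at h1
    exact h1

end Differentiation

end ContFamilyGroupoid

/-! ### The unit space and proper actions -/

/-- The range map is a continuous left inverse of `unit`. Through this embedding `B` inherits the
Hausdorff property, second countability and local compactness from `G`. -/
theorem TopGroupoid.isClosedEmbedding_unit {B G : Type*} [TopologicalSpace B]
    [TopologicalSpace G] [T2Space G] (𝓖 : TopGroupoid B G) :
    Topology.IsClosedEmbedding 𝓖.unit :=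
  Function.LeftInverse.isClosedEmbedding 𝓖.r_unit 𝓖.continuous_r 𝓖.continuous_unit

theorem ContFamilyGroupoid.IsContinuousLeftHaarSystem.isOpenPosMeasure {B G : Type*}
    [TopologicalSpace B] [TopologicalSpace G] [MeasurableSpace G] [BorelSpace G]
    {𝓖 : ContFamilyGroupoid B G} {lam : (u : B) → Measure {g : G // 𝓖.r g = u}}
    (hlam : 𝓖.IsContinuousLeftHaarSystem lam) (u : B) : (lam u).IsOpenPosMeasure where
  open_pos U hU hne := by
    obtain ⟨g, hg⟩ := hne
    have h : g ∈ (lam u).support := by rw [hlam.support_eq u]; trivial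
    exact (Measure.mem_support_iff_forall g |>.1 h U (hU.mem_nhds hg)).ne'

namespace CInfZeroGSpace

section Action

variable {B G X : Type*} [TopologicalSpace B] [TopologicalSpace G] [TopologicalSpace X]
  {𝓖 : ContFamilyGroupoid B G} {p : X → B}

theorem act_congr (𝓧 : CInfZeroGSpace 𝓖 p) {g g' : G} {x x' : X} (hg : g = g') (hx : x = x')
    (e : 𝓖.s g = p x) (e' : 𝓖.s g' = p x') : 𝓧.act g x e = 𝓧.act g' x' e' := by
  subst hg hx
  rfl

/-- That units act trivially is not an axiom: it follows from `g⁻¹ (g x) = x` with `g` a unit,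
because `g⁻¹ g` is then that same unit. -/
theorem unit_act (𝓧 : CInfZeroGSpace 𝓖 p) (x : X) :
    𝓧.act (𝓖.unit (p x)) x (𝓖.s_unit _) = x := by
  have h := 𝓧.inv_act_act (𝓖.unit (p x)) x (𝓖.s_unit _)
  rw [𝓧.act_act _ _ _ (𝓖.s_inv _)] at h
  refine (𝓧.act_congr ?_ rfl _ _).trans h
  rw [𝓖.inv_mul, 𝓖.s_unit]

theorem act_inv_act (𝓧 : CInfZeroGSpace 𝓖 p) (g : G) (x : X) (e : 𝓖.r g = p x) :
    𝓧.act g (𝓧.act (𝓖.inv g) x ((𝓖.s_inv g).trans e))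
      ((𝓖.r_inv g).symm.trans (𝓧.proj_act _ _ _).symm) = x := by
  rw [𝓧.act_act g (𝓖.inv g) x (𝓖.r_inv g).symm]
  refine (𝓧.act_congr ?_ rfl _ _).trans (𝓧.unit_act x)
  rw [𝓖.mul_inv, e]

open Classical in
/-- The map `(g, x) ↦ g⁻¹ x` for `r g = p x`, extended by `x`. -/
noncomputable def invAct (𝓧 : CInfZeroGSpace 𝓖 p) (g : G) (x : X) : X :=
  if e : 𝓖.r g = p x then 𝓧.act (𝓖.inv g) x ((𝓖.s_inv g).trans e) else x

theorem invAct_eq (𝓧 : CInfZeroGSpace 𝓖 p) {g : G} {x : X} (e : 𝓖.r g = p x) :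
    𝓧.invAct g x = 𝓧.act (𝓖.inv g) x ((𝓖.s_inv g).trans e) :=
  dif_pos e

theorem invAct_act (𝓧 : CInfZeroGSpace 𝓖 p) {g : G} {x : X} (e : 𝓖.s g = p x) :
    𝓧.invAct g (𝓧.act g x e) = x := by
  rw [𝓧.invAct_eq (𝓧.proj_act g x e).symm, 𝓧.inv_act_act]

theorem exists_act_eq_of_proj_eq (𝓧 : CInfZeroGSpace 𝓖 p) {g : G} {x : X} (e : 𝓖.r g = p x) :
    ∃ e' : 𝓖.s g = p (𝓧.invAct g x), 𝓧.act g (𝓧.invAct g x) e' = x := by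
  rw [𝓧.invAct_eq e]
  exact ⟨_, 𝓧.act_inv_act g x e⟩

/-- Write `h y = (h k) (k⁻¹ y)` and cancel `h k`. This is the algebra behind the invariance of
averages. -/
theorem invAct_mul_act (𝓧 : CInfZeroGSpace 𝓖 p) {h k : G} {y : X} (e : 𝓖.s h = p y)
    (ek : 𝓖.s h = 𝓖.r k) : 𝓧.invAct (𝓖.mul h k ek) (𝓧.act h y e) = 𝓧.invAct k y := by
  obtain ⟨e', hz⟩ := 𝓧.exists_act_eq_of_proj_eq (ek.symm.trans e)
  have h1 : 𝓧.act h y e = 𝓧.act (𝓖.mul h k ek) (𝓧.invAct k y) ((𝓖.s_mul h k ek).trans e') := by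
    rw [← 𝓧.act_act h k _ ek e']
    exact 𝓧.act_congr rfl hz.symm _ _
  rw [h1, 𝓧.invAct_act]

theorem continuousOn_invAct (𝓧 : CInfZeroGSpace 𝓖 p) :
    ContinuousOn (fun a : G × X => 𝓧.invAct a.1 a.2) {a | 𝓖.r a.1 = p a.2} := by
  rw [continuousOn_iff_continuous_domRestrict]
  have h1 : Continuous fun a : {a : G × X | 𝓖.r a.1 = p a.2} =>
      (⟨(𝓖.inv a.1.1, a.1.2), (𝓖.s_inv _).trans a.2⟩ : {a : G × X // 𝓖.s a.1 = p a.2}) :=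
    ((𝓖.continuous_inv.comp (continuous_fst.comp continuous_subtype_val)).prodMk
      (continuous_snd.comp continuous_subtype_val)).subtype_mk _
  exact (𝓧.continuous_act.comp h1).congr fun a => (𝓧.invAct_eq a.2).symm

theorem continuous_invAct_fibre (𝓧 : CInfZeroGSpace 𝓖 p) (x : X) :
    Continuous fun g : {g : G // 𝓖.r g = p x} => 𝓧.invAct g.1 x :=
  𝓧.continuousOn_invAct.comp_continuous (f := fun g : {g : G // 𝓖.r g = p x} => (g.1, x))
    (by fun_prop) fun g => g.2

/-- The pair `(g, g⁻¹ x)` is sent to `(x, g⁻¹ x) ∈ K ×ˢ L` by the map in the definition of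
properness, so `Q` is the projection to `G` of a compact preimage. -/
theorem IsProper.exists_isCompact {𝓧 : CInfZeroGSpace 𝓖 p} (h𝓧 : 𝓧.IsProper) {K L : Set X}
    (hK : IsCompact K) (hL : IsCompact L) :
    ∃ Q : Set G, IsCompact Q ∧
      ∀ g x, 𝓖.r g = p x → x ∈ K → 𝓧.invAct g x ∈ L → g ∈ Q := by
  refine ⟨_, (h𝓧 _ (hK.prod hL)).image (continuous_fst.comp continuous_subtype_val),
    fun g x e hx hxL => ?_⟩
  obtain ⟨e', hz⟩ := 𝓧.exists_act_eq_of_proj_eq e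
  exact ⟨⟨(g, 𝓧.invAct g x), e'⟩, ⟨by simpa only [hz] using hx, hxL⟩, rfl⟩

theorem hasCompactSupport_comp_invAct [T2Space G] {𝓧 : CInfZeroGSpace 𝓖 p}
    (h𝓧 : 𝓧.IsProper) {b : X → ℝ} (hbc : HasCompactSupport b) (x : X) :
    HasCompactSupport fun g : {g : G // 𝓖.r g = p x} => b (𝓧.invAct g.1 x) := by
  have := 𝓖.isClosedEmbedding_unit.isEmbedding.t2Space
  obtain ⟨Q, hQ, hxQ⟩ := h𝓧.exists_isCompact (isCompact_singleton (x := x)) hbc.isCompact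
  refine .intro (𝓖.isCompact_fibre_preimage hQ (p x)) fun g hg => ?_
  by_contra hne
  exact hg (hxQ _ _ g.2 rfl (subset_tsupport _ hne))

/-- The action is smooth in the pull-back chart at `(g⁻¹, w)`. Since `g` is only a parameter,
precomposing with inversion is a base change and needs just its continuity. -/
theorem cInfZeroAt_comp_invAct (𝓧 : CInfZeroGSpace 𝓖 p) {F : Type*} [NormedAddCommGroup F]
    [NormedSpace ℝ F] {h : X → F} (hh : 𝓧.fam.IsSmooth h)
    {ψ : OpenPartialHomeomorph X (B × EuclideanSpace ℝ (Fin 𝓧.fam.dim))}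
    (hψ : ψ ∈ 𝓧.fam.atlas) {y : G × EuclideanSpace ℝ (Fin 𝓧.fam.dim)}
    (hy : (𝓖.r y.1, y.2) ∈ ψ.target) :
    CInfZeroAt (fun y : G × EuclideanSpace ℝ (Fin 𝓧.fam.dim) =>
      h (𝓧.invAct y.1 (ψ.symm (𝓖.r y.1, y.2)))) y := by
  have h1 := hh.comp_morphism 𝓧.act_morphism _ ⟨ψ, hψ, rfl⟩ (𝓖.inv y.1, y.2)
    (show (𝓖.s (𝓖.inv y.1), y.2) ∈ ψ.target by rwa [𝓖.s_inv])
  refine (CInfZeroAt.baseChange (q := 𝓖.inv) h1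
    𝓖.continuous_inv.continuousAt).congr_of_eventuallyEq ?_
  have hc : Continuous fun y : G × EuclideanSpace ℝ (Fin 𝓧.fam.dim) => (𝓖.r y.1, y.2) :=
    (𝓖.continuous_r.comp continuous_fst).prodMk continuous_snd
  filter_upwards [(ψ.open_target.preimage hc).mem_nhds hy] with a ha
  have ha' : (𝓖.s (𝓖.inv a.1), a.2) ∈ ψ.target := by rwa [𝓖.s_inv]
  have he := 𝓧.fam.pullbackChart_symm_apply 𝓖.continuous_s hψ
    (b := (𝓖.inv a.1, a.2)) ha'
  refine congrArg h ((𝓧.invAct_eq (𝓧.fam.proj_symm hψ ha).symm).trans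
    (𝓧.act_congr (congrArg (fun c => c.1.1) he.symm)
      (Eq.trans ?_ (congrArg (fun c => c.1.2) he.symm)) _ _))
  simp only [𝓖.s_inv]

/-! ### Averaging over the groupoid -/

/-- The average `x ↦ ∫ b (g⁻¹ x) dλ^{p x}(g)` of a function over the groupoid. -/
noncomputable def average (𝓧 : CInfZeroGSpace 𝓖 p) [MeasurableSpace G]
    (lam : (u : B) → Measure {g : G // 𝓖.r g = u}) (b : X → ℝ) (x : X) : ℝ :=
  ∫ g : {g : G // 𝓖.r g = p x}, b (𝓧.invAct g.1 x) ∂(lam (p x))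

theorem average_eq (𝓧 : CInfZeroGSpace 𝓖 p) [MeasurableSpace G]
    (lam : (u : B) → Measure {g : G // 𝓖.r g = u}) (b : X → ℝ) {x : X} {u : B} (hu : p x = u) :
    𝓧.average lam b x = ∫ g : {g : G // 𝓖.r g = u}, b (𝓧.invAct g.1 x) ∂(lam u) := by
  subst hu
  rfl

variable [T2Space G] [MeasurableSpace G] [BorelSpace G]
  {lam : (u : B) → Measure {g : G // 𝓖.r g = u}} {𝓧 : CInfZeroGSpace 𝓖 p}

theorem isSmooth_average [LocallyCompactSpace G] [SecondCountableTopology G] [LocallyCompactSpace X]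
    (hlam : 𝓖.IsContinuousLeftHaarSystem lam) (h𝓧 : 𝓧.IsProper) {b : X → ℝ}
    (hb : 𝓧.fam.IsSmooth b) (hbc : HasCompactSupport b) :
    𝓧.fam.IsSmooth (𝓧.average lam b) := by
  have := 𝓖.isClosedEmbedding_unit.isEmbedding.t2Space
  have := 𝓖.isClosedEmbedding_unit.isEmbedding.secondCountableTopology
  intro ψ hψ z hz
  -- A compact neighbourhood `K` is used instead of a point so that one compact `Q` bounds the
  -- supports of the integrands for all nearby `x`.
  obtain ⟨K, hK, hzK, hKψ⟩ := exists_compact_subset ψ.open_source (ψ.map_target hz)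
  obtain ⟨Q, hQ, hKQ⟩ := h𝓧.exists_isCompact hK hbc.isCompact
  have hW : IsOpen (ψ.target ∩ ψ.symm ⁻¹' interior K) :=
    ψ.symm.isOpen_inter_preimage isOpen_interior
  refine (𝓖.cInfZeroAt_integral_fibre hlam hW
    (fun y hy => 𝓧.cInfZeroAt_comp_invAct hb hψ hy.1) hQ (fun y hy hyQ => ?_)
    ⟨hz, hzK⟩).congr_of_eventuallyEq ?_
  · by_contra hne
    exact hyQ (hKQ _ _ (𝓧.fam.proj_symm hψ hy.1).symm (interior_subset hy.2)
      (subset_tsupport _ hne))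
  · filter_upwards [ψ.open_target.mem_nhds hz] with y hy
    rw [𝓧.average_eq lam b (𝓧.fam.proj_symm hψ hy)]
    refine integral_congr_ae (.of_forall fun g => ?_)
    simp only [g.2]

/-- The integrand is continuous, non-negative and compactly supported, it is positive at `g`, and
the Haar measure charges every non-empty open set. -/
theorem average_pos (hlam : 𝓖.IsContinuousLeftHaarSystem lam) (h𝓧 : 𝓧.IsProper) {b : X → ℝ}
    (hb : Continuous b) (hbc : HasCompactSupport b) (hb0 : ∀ x, 0 ≤ b x) {x : X} {g : G}
    (e : 𝓖.r g = p x) (hg : 0 < b (𝓧.invAct g x)) : 0 < 𝓧.average lam b x := by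
  have := hlam.regular (p x)
  have := hlam.isOpenPosMeasure (p x)
  exact (hb.comp (𝓧.continuous_invAct_fibre x)).integral_pos_of_hasCompactSupport_nonneg_nonzero
    (hasCompactSupport_comp_invAct h𝓧 hbc x) (fun _ => hb0 _) (x := ⟨g, e⟩) hg.ne'

/-- Averages are invariant under the groupoid. -/
theorem average_act [LocallyCompactSpace G] [SecondCountableTopology G]
    (hlam : 𝓖.IsContinuousLeftHaarSystem lam) (h𝓧 : 𝓧.IsProper) {b : X → ℝ} (hb : Continuous b)
    (hbc : HasCompactSupport b) {h : G} {y : X} (e : 𝓖.s h = p y) :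
    𝓧.average lam b (𝓧.act h y e) = 𝓧.average lam b y := by
  have := 𝓖.isClosedEmbedding_unit.isEmbedding.t2Space
  obtain ⟨Q, hQ, hxQ⟩ := h𝓧.exists_isCompact (isCompact_singleton (x := 𝓧.act h y e))
    hbc.isCompact
  have hcl : IsClosed {g | 𝓖.r g = 𝓖.r h} := isClosed_singleton.preimage 𝓖.continuous_r
  have hcont : ContinuousOn (fun g => b (𝓧.invAct g (𝓧.act h y e))) {g | 𝓖.r g = 𝓖.r h} :=
    hb.comp_continuousOn (𝓧.continuousOn_invAct.comp (Continuous.prodMk_left _).continuousOn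
      fun g hg => Eq.trans hg (𝓧.proj_act h y e).symm)
  -- Left invariance is available only for compactly supported continuous functions on all of `G`,
  -- while the integrand lives on one closed fibre. Tietze's theorem extends it, and the cutoff `χ`,
  -- equal to `1` on `Q`, makes the support compact without changing values on the fibre.
  obtain ⟨k, hk⟩ := ContinuousMap.exists_restrict_eq hcl
    (⟨_, continuousOn_iff_continuous_domRestrict.1 hcont⟩ : C({g | 𝓖.r g = 𝓖.r h}, ℝ))
  have hk' : ∀ g, 𝓖.r g = 𝓖.r h → k g = b (𝓧.invAct g (𝓧.act h y e)) := fun g hg =>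
    DFunLike.congr_fun hk ⟨g, hg⟩
  obtain ⟨χ, hχ1, -, hχc, -⟩ := exists_continuous_one_zero_of_isCompact hQ isClosed_empty
    (disjoint_empty Q)
  have hχk : ∀ g, 𝓖.r g = 𝓖.r h → χ g * k g = b (𝓧.invAct g (𝓧.act h y e)) := by
    intro g hg
    rw [hk' g hg]
    by_cases hgQ : g ∈ Q
    · rw [hχ1 hgQ, Pi.one_apply, one_mul]
    · have : b (𝓧.invAct g (𝓧.act h y e)) = 0 := by
        by_contra hne
        exact hgQ (hxQ _ _ (hg.trans (𝓧.proj_act h y e).symm) rfl (subset_tsupport _ hne))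
      rw [this, mul_zero]
  have hinv := hlam.left_invariant h (fun g => ((χ g * k g : ℝ) : ℂ))
    (Complex.continuous_ofReal.comp (χ.continuous.mul k.continuous))
    (hχc.mul_right.comp_left (g := fun a : ℝ => (a : ℂ)) Complex.ofReal_zero)
  rw [integral_complex_ofReal, integral_complex_ofReal, Complex.ofReal_inj] at hinv
  rw [𝓧.average_eq lam b (𝓧.proj_act h y e), 𝓧.average_eq lam b e.symm]
  refine Eq.trans ?_ (hinv.symm.trans ?_)
  · exact integral_congr_ae (.of_forall fun g => (hχk g.1 g.2).symm)
  · refine integral_congr_ae (.of_forall fun g => ?_)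
    simp only
    rw [hχk _ (𝓖.r_mul _ _ _), 𝓧.invAct_mul_act]

end Action

end CInfZeroGSpace

/-! ### Normalisation by the average. -/

theorem mainTheorem9 {B G X : Type*} [TopologicalSpace B]
    [TopologicalSpace G] [LocallyCompactSpace G] [T2Space G] [SecondCountableTopology G]
    [MeasurableSpace G] [BorelSpace G]
    [TopologicalSpace X] [LocallyCompactSpace X] [T2Space X] [SecondCountableTopology X]
    (𝓖 : ContFamilyGroupoid B G)
    (lam : (u : B) → MeasureTheory.Measure {g : G // 𝓖.r g = u})
    (hlam : 𝓖.IsContinuousLeftHaarSystem lam)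
    (p : X → B) (𝓧 : CInfZeroGSpace 𝓖 p)
    (hproper : 𝓧.IsProper) (hcompact : 𝓧.IsGCompact) :
    ∃ c : X → ℂ, 𝓧.fam.MemCcInfZero c ∧ (∀ x, 0 ≤ c x) ∧
      ∀ x : X, ∫ g : {g : G // 𝓖.r g = p x},
        c (𝓧.act (𝓖.inv g.1) x ((𝓖.s_inv g.1).trans g.2)) ∂(lam (p x)) = 1 := by
  have := 𝓖.isClosedEmbedding_unit.isEmbedding.t2Space
  have := 𝓖.isClosedEmbedding_unit.locallyCompactSpace
  obtain ⟨C, hC, hCX⟩ := hcompact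
  obtain ⟨b, hb, hbc, hb0, hbC⟩ := 𝓧.fam.exists_isSmooth_pos_on hC
  have hpos : ∀ x, 0 < 𝓧.average lam b x := by
    intro x
    -- With `x = g y` and `y ∈ C`, the integrand takes the value `b y > 0` at `g`.
    obtain ⟨g, y, e, hy, rfl⟩ := hCX x
    refine CInfZeroGSpace.average_pos hlam hproper hb.continuous hbc hb0
      (𝓧.proj_act g y e).symm ?_
    rw [𝓧.invAct_act]
    exact hbC y hy
  have hsm : 𝓧.fam.IsSmooth fun x => ((b x * (𝓧.average lam b x)⁻¹ : ℝ) : ℂ) := by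
    intro φ hφ z hz
    have h1 := CInfZeroGSpace.isSmooth_average hlam hproper hb hbc φ hφ z hz
    exact ((hb φ hφ z hz).smul (h1.inv (hpos _).ne')).contDiffAt_comp
      (h := fun a : ℝ => (a : ℂ)) (.of_forall fun _ => Complex.ofRealCLM.contDiff.contDiffAt)
  refine ⟨fun x => ((b x * (𝓧.average lam b x)⁻¹ : ℝ) : ℂ), ⟨hsm.continuous, ?_, ?_⟩, ?_, ?_⟩
  · exact (hbc.mul_right (f' := fun x => (𝓧.average lam b x)⁻¹)).comp_left
      (g := fun a : ℝ => (a : ℂ)) Complex.ofReal_zero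
  · exact fun φ hφ => cInfZeroOn_of_forall_cInfZeroAt φ.open_target (hsm φ hφ)
  · intro x
    rw [Complex.zero_le_real]
    exact mul_nonneg (hb0 x) (inv_nonneg.2 (hpos x).le)
  · intro x
    -- The normalising factor is constant along the orbit of `x`, so it can be taken out of the
    -- integral.
    have key : ∀ g : {g : G // 𝓖.r g = p x},
        b (𝓧.act (𝓖.inv g.1) x ((𝓖.s_inv g.1).trans g.2)) *
          (𝓧.average lam b (𝓧.act (𝓖.inv g.1) x ((𝓖.s_inv g.1).trans g.2)))⁻¹ =
        b (𝓧.invAct g.1 x) * (𝓧.average lam b x)⁻¹ := by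
      intro g
      rw [𝓧.invAct_eq g.2, CInfZeroGSpace.average_act hlam hproper hb.continuous hbc]
    simp only [key]
    rw [integral_complex_ofReal, integral_mul_const]
    change ((𝓧.average lam b x * (𝓧.average lam b x)⁻¹ : ℝ) : ℂ) = 1
    rw [mul_inv_cancel₀ (hpos x).ne', Complex.ofReal_one]
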